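/- Consider episodic MDPs $M=(\mathcal S,\mathcal A,R,P,\mu_0,H)$ with finite state and action sets, $|\mathcal S|=S$, $|\mathcal A|=A$, and episode length $H$. The diameter $D$ of $M$ is $\max_{s}\min T$, where the minimum is over all paths $s_0,a_0,s_1,\dots,s_T=s$ with $\mu_0(s_0)>0$ and $P(s_{t+1}\mid s_t,a_t)>0$. Learner. A learner $L\in\mathcal L$ has an exploration probability $\epsilon\in[0,1]$: in state $s$ with table $Q_t$ it plays a maximizer $a^*$ of $Q_t(s,\cdot)$ (ties broken by any, possibly randomized, rule) with probability $1-\epsilon$, and a uniformly random action other than $a^*$ with probability $\epsilon$ (if $A=1$, it plays the only action). Its update $Q_{t+1}=f(Q_t,(s_t,a_t,r_t,s_{t+1}))$ only changes the entry $(s_t,a_t)$, and for all $Q_t,s_t,a_t,s_{t+1}$ there are rewards $r_t$ that make $a_t$ strictly first in $Q_{t+1}(s_t,\cdot)$, strictly last, or leave its rank unchanged. Teacher. A Level 3 teacher knows the past. It chooses the first state $s_0$ of each episode ($H$ steps) with $\mu_0(s_0)>0$ and, after the learner's action $a_t$, any reward $r_t\in\mathbb R$ and any next state with $P(s_{t+1}\mid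 s_t,a_t)>0$. Teaching of a target policy $\pi^\dagger$ ends at the first time $T$ at which $\operatorname{argmax}_a Q_T(s,a)=\{\pi^\dagger(s)\}$ for every $s$. Let $\mathrm{METaL}(M,L,Q_0,\pi^\dagger)$ be the infimum of $\mathbb E[T]$ over Level 3 teachers, and $\mathrm{TDim}(L,\mathcal M)=\sup_{M\in\mathcal M,\,Q_0,\,\pi^\dagger}\mathrm{METaL}(M,L,Q_0,\pi^\dagger)$. Theorem. There is a universal constant $C$ such that for every learner $L\in\mathcal L$ with exploration probability $\epsilon$ and every family $\mathcal M$ of MDPs with $S$ states, $A$ actions, episode length $H$ and diameter $D<H$, $$\mathrm{TDim}(L,\mathcal M)\le C\,S A H\left(\frac1{1-\epsilon}\right)^{D}.$$ Moreover, NavTeach is well defined on every $M\in\mathcal M$ and for all $Q_0,\pi^\dagger$, and its expected teaching length is at most $$(2S-1)(A-1)\,H\,(1-\epsilon)^{-D},$$ provided that no two entries of any row $Q_0(s,\cdot)$ are equal, or that $\epsilon\le (A-1)/A$. (Here $1/0=\infty$, $\infty^0=1$ and $0\cdot\infty=0$.) NavTeach is the following Level 3 teacher. Fix a breadth-first forest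 of the directed graph of supported transitions, rooted at the initial states $\{\mu_0>0\}$ (a breadth-first tree if there is one initial state), and enumerate the states as $s^1,\dots,s^S$ by a post-order depth-first traversal. While teaching is not completed, let $g$ be the first $s^i$ with $\operatorname{argmax}_aQ_t(s^i,a)\ne\{\pi^\dagger(s^i)\}$. Episodes start at the root of the tree of $g$. When the learner plays $a$ in state $s$: if $s=g$, reward so that $a$ becomes first if $a=\pi^\dagger(g)$ and last otherwise, and move to any supported state; if $s\neq g$ lies on the tree path from the root to $g$, with successor $c$ on it, then if $P(c\mid s,a)>0$ move to $c$ and reward so that $a$ becomes first, else move to any supported state and reward so that $a$ becomes last; in any other state move to any supported state and keep the rank of $a$. The bound holds for every choice of forest, enumeration, rewards and next states that obeys these rules. -/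

import Mathlib

open scoped ENNReal NNReal

noncomputable section

namespace Teaching

universe u v

/-! ## The environment -/

/-- An episodic Markov decision process with state space `S` and action space `A`: rewards `R`,
transition law `P s a`, initial state law `μ₀`, episode length `H`. -/
structure MDP (S : Type u) (A : Type v) where
  R : S → A → ℝ
  P : S → A → PMF S
  μ₀ : PMF S
  H : ℕ

variable {S : Type u} {A : Type v}

namespace MDP

/-- `M.Supp s a s'`: the transition from `s` to `s'` under `a` has positive probability. -/
def Supp (M : MDP S A) (s : S) (a : A) (s' : S) : Prop := 0 < M.P s a s'

/-- `M.Init s`: the state `s` has positive initial probability. -/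
def Init (M : MDP S A) (s : S) : Prop := 0 < M.μ₀ s

/-- `M.Reaches n s`: there are `s₀, a₀, s₁, a₁, …, sₙ = s` with `μ₀ s₀ > 0` and
`P(sₜ₊₁ ∣ sₜ, aₜ) > 0` for all `t < n`. -/
inductive Reaches (M : MDP S A) : ℕ → S → Prop
  | init {s : S} (h : M.Init s) : Reaches M 0 s
  | step {n : ℕ} {s s' : S} {a : A} (h : Reaches M n s) (hs : M.Supp s a s') :
      Reaches M (n + 1) s'

/-- The least length of a path from an initial state to `s` (`⊤` if there is none). -/
def dist (M : MDP S A) (s : S) : ℕ∞ := ⨅ (n : ℕ) (_ : M.Reaches n s), (n : ℕ∞)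

/-- The diameter: the distance of the hardest-to-get-to state. -/
def diam (M : MDP S A) : ℕ∞ := ⨆ s : S, M.dist s

end MDP

/-! ## The learner -/

/-- A table of `Q`-values. -/
abbrev QTable (S : Type u) (A : Type v) := S → A → ℝ

/-- An experience `(sₜ, aₜ, rₜ, sₜ₊₁)`. -/
@[ext]
structure Experience (S : Type u) (A : Type v) where
  state : S
  action : A
  reward : ℝ
  next : S

/-- `a` is strictly above all other actions in `Q(s, ·)`, i.e. `argmax Q(s, ·) = {a}`. -/
def RankedFirst (Q : QTable S A) (s : S) (a : A) : Prop := ∀ b, b ≠ a → Q s b < Q s a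

/-- `a` is strictly below all other actions in `Q(s, ·)`. -/
def RankedLast (Q : QTable S A) (s : S) (a : A) : Prop := ∀ b, b ≠ a → Q s a < Q s b

/-- `a` compares with every other action in `Q'(s, ·)` exactly as it does in `Q(s, ·)`. -/
def SameRank (Q Q' : QTable S A) (s : S) (a : A) : Prop :=
  ∀ b, (Q' s a < Q' s b ↔ Q s a < Q s b) ∧ (Q' s b < Q' s a ↔ Q s b < Q s a)

/-- A learner: an exploration probability `ε ∈ [0, 1]`, an update rule `Qₜ₊₁ = update Qₜ eₜ`, and
a rule (possibly randomized) that selects the greedy action among the maximizers of `Q(s, ·)`. The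
update only changes the entry of the current state and action, and for a suitable reward it makes
the current action the first one, or the last one, or leaves its rank unchanged. -/
structure Learner (S : Type u) (A : Type v) where
  ε : ℝ≥0
  ε_le_one : ε ≤ 1
  greedy : QTable S A → S → PMF A
  greedy_argmax : ∀ Q s a, a ∈ (greedy Q s).support → ∀ b, Q s b ≤ Q s a
  update : QTable S A → Experience S A → QTable S A
  update_other : ∀ Q e s a, ¬ (s = e.state ∧ a = e.action) → update Q e s a = Q s a
  exists_promote : ∀ Q s a s', ∃ r, RankedFirst (update Q ⟨s, a, r, s'⟩) s a
  exists_demote : ∀ Q s a s', ∃ r, RankedLast (update Q ⟨s, a, r, s'⟩) s a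
  exists_maintain : ∀ Q s a s', ∃ r, SameRank Q (update Q ⟨s, a, r, s'⟩) s a

open Classical in
/-- The uniform law on the actions other than `a` (the point mass at `a` if there are none). -/
def otherAction [Fintype A] (a : A) : PMF A :=
  if h : (Finset.univ.erase a).Nonempty then PMF.uniformOfFinset (Finset.univ.erase a) h
  else PMF.pure a

namespace Learner

/-- The behavior policy: the greedy action with probability `1 - ε`, and with probability `ε` a
uniformly random other action. -/
def behavior [Fintype A] (L : Learner S A) (Q : QTable S A) (s : S) : PMF A :=
  (L.greedy Q s).bind fun a =>
    (PMF.bernoulli L.ε L.ε_le_one).bind fun explore =>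
      if explore then otherAction a else PMF.pure a

end Learner

/-! ## Teaching by reinforcement -/

/-- The experiences given so far, the most recent one first. -/
abbrev History (S : Type u) (A : Type v) := List (Experience S A)

/-- The learner's `Q`-table after the history `h`, from the initial table `Q₀`. -/
def Learner.table (L : Learner S A) (Q₀ : QTable S A) : History S A → QTable S A
  | [] => Q₀
  | e :: h => L.update (Learner.table L Q₀ h) e

/-- The target policy `π` is learned: in every state it is the unique greedy action. -/
def Learned (π : S → A) (Q : QTable S A) : Prop := ∀ s, RankedFirst Q s (π s)

/-- A teaching strategy, which knows everything that happened so far: it chooses the first state of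
every episode and, after the learner has chosen its action, the reward and the next state. -/
structure Teacher (S : Type u) (A : Type v) where
  start : History S A → S
  reward : History S A → A → ℝ
  next : History S A → A → S

namespace Teacher

/-- The state the learner is in after the history `h`; an episode starts every `H` steps. -/
def current (T : Teacher S A) (H : ℕ) (h : History S A) : S :=
  match h with
  | [] => T.start []
  | e :: h' => if (e :: h').length % H = 0 then T.start (e :: h') else e.next

/-- A Level 3 teacher: arbitrary rewards, but the initial states and the transitions are in the
support of the MDP. -/
def IsLevelThree (T : Teacher S A) (M : MDP S A) : Prop :=
  ∀ h, M.Init (T.start h) ∧ ∀ a, M.Supp (T.current M.H h) a (T.next h a)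

/-- The experience given after the history `h` when the learner picks `a`. -/
def experience (T : Teacher S A) (M : MDP S A) (h : History S A) (a : A) : Experience S A :=
  ⟨T.current M.H h, a, T.reward h a, T.next h a⟩

variable [Fintype A]

open Classical in
/-- The law of the history after at most `n` teaching steps; teaching ends as soon as the target
policy `π` is learned. -/
def run (T : Teacher S A) (M : MDP S A) (L : Learner S A) (Q₀ : QTable S A) (π : S → A) :
    ℕ → PMF (History S A)
  | 0 => PMF.pure []
  | n + 1 => (run T M L Q₀ π n).bind fun h =>
      if Learned π (L.table Q₀ h) then PMF.pure h
      else (L.behavior (L.table Q₀ h) (T.current M.H h)).map fun a => T.experience M h a :: h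

/-- The expected number `𝔼 T` of teaching steps until the target policy is learned, as the limit of
`𝔼 (min T n)`; the history after at most `n` steps has length `min T n`. -/
def expectedLength (T : Teacher S A) (M : MDP S A) (L : Learner S A) (Q₀ : QTable S A)
    (π : S → A) : ℝ≥0∞ :=
  ⨆ n : ℕ, ∑' h : History S A, T.run M L Q₀ π n h * (h.length : ℝ≥0∞)

end Teacher

/-- The minimum expected teaching length of a Level 3 teacher. -/
def METaL [Fintype A] (M : MDP S A) (L : Learner S A) (Q₀ : QTable S A) (π : S → A) : ℝ≥0∞ :=
  ⨅ (T : Teacher S A) (_ : T.IsLevelThree M), T.expectedLength M L Q₀ π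

/-- The Level 3 teaching dimension of the learner `L` with respect to the family `𝓜` of MDPs. -/
def TDim [Fintype A] (L : Learner S A) (𝓜 : Set (MDP S A)) : ℝ≥0∞ :=
  ⨆ (M : MDP S A) (_ : M ∈ 𝓜) (Q₀ : QTable S A) (π : S → A), METaL M L Q₀ π

/-! ## Navigation-then-Teach -/

/-- The relation "`u` is an ancestor of `v`, or `v` itself" of a parent function. -/
def Ancestor (parent : S → Option S) : S → S → Prop :=
  Relation.ReflTransGen fun u v => parent v = some u

/-- A breadth-first forest of the transition graph, rooted at the initial states (a tree if the
initial state is unique), with an enumeration of the states by a post-order depth-first traversal: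
the descendants of a state `v` form a contiguous block of the enumeration that ends with `v`. -/
structure NavPlan [Fintype S] (M : MDP S A) where
  parent : S → Option S
  root_init : ∀ s, parent s = none → M.Init s
  edge_supp : ∀ u s, parent s = some u → ∃ a, M.Supp u a s
  breadth_first : ∀ u s, parent s = some u → M.dist s = M.dist u + 1
  pos : S ≃ Fin (Fintype.card S)
  descendant_le : ∀ u v, Ancestor parent v u → pos u ≤ pos v
  descendant_block : ∀ u v w, Ancestor parent v u → pos u ≤ pos w → pos w ≤ pos v →
    Ancestor parent v w

/-- `g` is the state of the current subtask: the first state of the enumeration in which the target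
action is not yet learned. -/
def NavPlan.IsSubtask [Fintype S] {M : MDP S A} (p : NavPlan M) (π : S → A) (Q : QTable S A)
    (g : S) : Prop :=
  ¬ RankedFirst Q g (π g) ∧ ∀ s, p.pos s < p.pos g → RankedFirst Q s (π s)

/-- The teacher `T` acts as NavTeach does for the plan `p`. In the subtask of `g`, every episode
starts at the root of the tree of `g`. Let `s` be the current state and `a` the learner's action.
* If `s = g`, the action `a` is promoted to the first rank if it is the target action, and demoted
  to the last rank otherwise.
* If `s ≠ g` is on the path from the root to `g`, with `c` next on the path, and if the MDP supports
  the transition from `s` to `c` under `a`, then it is made and `a` is promoted; if not, `a` is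
  demoted.
* In all other states the rank of `a` is maintained.

Unless prescribed above, the next state is any supported one. -/
structure IsNavTeach [Fintype S] (M : MDP S A) (L : Learner S A) (Q₀ : QTable S A) (π : S → A)
    (p : NavPlan M) (T : Teacher S A) : Prop where
  level_three : T.IsLevelThree M
  start_root : ∀ h g, p.IsSubtask π (L.table Q₀ h) g →
    p.parent (T.start h) = none ∧ Ancestor p.parent (T.start h) g
  teach_promote : ∀ h g a, p.IsSubtask π (L.table Q₀ h) g → T.current M.H h = g → a = π g →
    RankedFirst (L.update (L.table Q₀ h) (T.experience M h a)) g a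
  teach_demote : ∀ h g a, p.IsSubtask π (L.table Q₀ h) g → T.current M.H h = g → a ≠ π g →
    RankedLast (L.update (L.table Q₀ h) (T.experience M h a)) g a
  navigate_promote : ∀ h g a s c, p.IsSubtask π (L.table Q₀ h) g → T.current M.H h = s →
    p.parent c = some s → Ancestor p.parent c g → M.Supp s a c →
    T.next h a = c ∧ RankedFirst (L.update (L.table Q₀ h) (T.experience M h a)) s a
  navigate_demote : ∀ h g a s c, p.IsSubtask π (L.table Q₀ h) g → T.current M.H h = s →
    p.parent c = some s → Ancestor p.parent c g → ¬ M.Supp s a c →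
    RankedLast (L.update (L.table Q₀ h) (T.experience M h a)) s a
  maintain : ∀ h g a s, p.IsSubtask π (L.table Q₀ h) g → T.current M.H h = s →
    ¬ Ancestor p.parent s g →
    SameRank (L.table Q₀ h) (L.update (L.table Q₀ h) (T.experience M h a)) s a

end Teaching

end

/-!
The proof compares the teaching process with a potential of the learner's table.

Let `g` be the state of the current subtask and consider the path from the root of its tree to `g`.
On an edge from `s` to `c` of this path, call an action a *blocker* if it does not support the
transition and is ranked at least as high as every action that does. The number of blockers never
increases: an action that does not support the transition is demoted, one that does is promoted.
If the learner acts greedily in `s`, then it either moves on to `c` or plays a blocker, which removes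
it. Since the learner acts greedily with probability at least `1 - ε` (`exploreMean_le`), an episode
reaches `g` or removes a blocker with probability at least `(1 - ε) ^ D`.

In `g` itself, if `k ≥ 1` of the `n = |A| - 1` other actions are not strictly below the target action,
a visit makes progress with probability `c k = 1 - ε + ε * k / n`, and `k / c k ≤ n` visits
suffice in expectation (`visits`, `isRowCost_navRule`). Ties are the only obstacle: if the target
action is itself the greedy one without being the unique maximizer, the estimate needs
`ε ≤ n / (n + 1)`.

The potential of a table adds the expected number of visits to `g`, the worst case `n` for every later
state, the number of blockers on the edges of the path to `g`, and the worst case `n` for the edges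
that are needed only later. Because the enumeration is a post-order, every edge is needed for one
contiguous block of subtasks, so the potential does not increase when the subtask changes
(`edgeCost_le_of_pos_lt`). It is at most `n * |S| + n * (|S| - 1)`, and in expectation every episode
decreases it by `(1 - ε) ^ D`. To get a bound for single steps, `remainingBound` deducts from the
potential the decrease still to be expected in the current episode (`gain`). On average it falls by
at least one per step (`Navigates.mean_potential_sub_gain_le`), and `Teacher.expectedLength_le`
applies.

For the teaching dimension there is no assumption on ties. If `ε > n / (n + 1)`, then `ε ≥ 1 / 2` and
the teacher that navigates in the same way but promotes *every* action in `g` does as well up to a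
constant: after one visit the greedy action is unique, and unless it is the target action already,
every further visit finds the target action by exploration with probability `ε / n`
(`isRowCost_promoteRule`).
-/

noncomputable section

namespace Teaching

universe u v

variable {S : Type u} {A : Type v}

/-! ### Expectations under the behavior policy and along a run -/

section Expectation

variable {α β : Type*}

theorem tsum_pmf_pure_mul (a : α) (g : α → ℝ≥0∞) : ∑' b, PMF.pure a b * g b = g a := by
  rw [tsum_eq_single a]
  · simp [PMF.pure_apply]
  · intro b hb
    simp [PMF.pure_apply, hb]

theorem tsum_pmf_bind_mul (p : PMF α) (f : α → PMF β) (g : β → ℝ≥0∞) :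
    ∑' b, p.bind f b * g b = ∑' a, p a * ∑' b, f a b * g b := by
  simp_rw [PMF.bind_apply, ← ENNReal.tsum_mul_right, ← ENNReal.tsum_mul_left, mul_assoc]
  exact ENNReal.tsum_comm

theorem tsum_pmf_map_mul (p : PMF α) (f : α → β) (g : β → ℝ≥0∞) :
    ∑' b, p.map f b * g b = ∑' a, p a * g (f a) := by
  rw [← PMF.bind_pure_comp, tsum_pmf_bind_mul]
  simp

theorem tsum_pmf_mul_le (p : PMF α) (g : α → ℝ≥0∞) (X : ℝ≥0∞)
    (h : ∀ a ∈ p.support, g a ≤ X) : ∑' a, p a * g a ≤ X := by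
  calc ∑' a, p a * g a ≤ ∑' a, p a * X := by
        refine ENNReal.tsum_le_tsum fun a => ?_
        by_cases ha : p a = 0
        · simp [ha]
        · gcongr
          exact h a ((PMF.mem_support_iff _ _).2 ha)
    _ = X := by rw [ENNReal.tsum_mul_right, p.tsum_coe, one_mul]

end Expectation

open Classical in
theorem tsum_otherAction_mul [Fintype A] (hA : 2 ≤ Fintype.card A) (a : A) (f : A → ℝ)
    (hf : ∀ b, 0 ≤ f b) :
    ∑' b, otherAction a b * ENNReal.ofReal (f b) =
      ENNReal.ofReal ((∑ b ∈ Finset.univ.erase a, f b) / ((Fintype.card A : ℝ) - 1)) := by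
  have hcard : (Finset.univ.erase a).card = Fintype.card A - 1 := by
    rw [Finset.card_erase_of_mem (Finset.mem_univ a), Finset.card_univ]
  have hne : (Finset.univ.erase a).Nonempty := by
    rw [← Finset.card_pos, hcard]; omega
  have hc : ((Fintype.card A - 1 : ℕ) : ℝ) = (Fintype.card A : ℝ) - 1 := by
    rw [Nat.cast_sub (by omega), Nat.cast_one]
  have hpos : (0 : ℝ) < ((Fintype.card A - 1 : ℕ) : ℝ) := by
    exact_mod_cast (by omega : 0 < Fintype.card A - 1)
  rw [otherAction, dif_pos hne, tsum_fintype, ← Finset.sum_subset (Finset.subset_univ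
    (Finset.univ.erase a)), div_eq_inv_mul, ENNReal.ofReal_mul (by rw [← hc]; positivity),
    ENNReal.ofReal_sum_of_nonneg fun b _ => hf b, Finset.mul_sum]
  · refine Finset.sum_congr rfl fun b hb => ?_
    rw [PMF.uniformOfFinset_apply_of_mem hne hb, hcard, ← hc, ENNReal.ofReal_inv_of_pos hpos,
      ENNReal.ofReal_natCast]
  · intro b _ hb
    rw [PMF.uniformOfFinset_apply_of_notMem hne hb, zero_mul]

/-- The expectation of `f` over the learner's action when its greedy action is `a`. -/
def exploreMean [Fintype A] (ε : ℝ) (f : A → ℝ) (a : A) : ℝ :=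
  open Classical in
  (1 - ε) * f a + ε * ((∑ b ∈ Finset.univ.erase a, f b) / ((Fintype.card A : ℝ) - 1))

set_option linter.deprecated false in
theorem tsum_behavior_mul_le [Fintype A] (hA : 2 ≤ Fintype.card A) (L : Learner S A)
    (Q : QTable S A) (s : S) (f : A → ℝ) (hf : ∀ b, 0 ≤ f b) (X : ℝ)
    (h : ∀ a, (∀ b, Q s b ≤ Q s a) → exploreMean L.ε f a ≤ X) :
    ∑' b, L.behavior Q s b * ENNReal.ofReal (f b) ≤ ENNReal.ofReal X := by
  rw [Learner.behavior, tsum_pmf_bind_mul]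
  refine tsum_pmf_mul_le _ _ _ fun a ha => ?_
  refine le_trans (le_of_eq ?_) (ENNReal.ofReal_le_ofReal (h a (L.greedy_argmax Q s a ha)))
  have hε : (L.ε : ℝ) ≤ 1 := by exact_mod_cast L.ε_le_one
  have hA' : (2 : ℝ) ≤ Fintype.card A := by exact_mod_cast hA
  rw [tsum_pmf_bind_mul, tsum_fintype, Fintype.sum_bool]
  simp only [PMF.bernoulli_apply, cond_true, cond_false, if_true, Bool.false_eq_true, if_false]
  rw [tsum_otherAction_mul hA a f hf, tsum_pmf_pure_mul, exploreMean, ENNReal.ofReal_add,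
    ENNReal.ofReal_mul (by linarith), ENNReal.ofReal_mul (by positivity), add_comm,
    ENNReal.ofReal_sub _ (by positivity), ENNReal.ofReal_one, ENNReal.ofReal_coe_nnreal]
  · rw [ENNReal.coe_sub, ENNReal.coe_one]
  · exact mul_nonneg (by linarith) (hf a)
  · exact mul_nonneg (by positivity)
      (div_nonneg (Finset.sum_nonneg fun b _ => hf b) (by linarith))

/-- If every action yields at most `X`, and the greedy action falls short of `X` by `x`, then the
mean falls short of `X` by `(1 - ε) * x`. -/
theorem exploreMean_le [Fintype A] (hA : 2 ≤ Fintype.card A) {ε : ℝ} (h0 : 0 ≤ ε) (h1 : ε ≤ 1)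
    {f : A → ℝ} {a : A} {X x : ℝ} (hX : ∀ b, f b ≤ X) (ha : f a ≤ X - x) :
    exploreMean ε f a ≤ X - (1 - ε) * x := by
  classical
  have hA' : (2 : ℝ) ≤ Fintype.card A := by exact_mod_cast hA
  have hsum : (∑ b ∈ Finset.univ.erase a, f b) / ((Fintype.card A : ℝ) - 1) ≤ X := by
    rw [div_le_iff₀ (by linarith)]
    have := Finset.sum_le_card_nsmul (Finset.univ.erase a) f X fun b _ => hX b
    rw [Finset.card_erase_of_mem (Finset.mem_univ a), Finset.card_univ, nsmul_eq_mul,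
      Nat.cast_sub (by omega), Nat.cast_one] at this
    linarith
  have e1 := mul_le_mul_of_nonneg_left ha (sub_nonneg.2 h1)
  have e2 := mul_le_mul_of_nonneg_left hsum h0
  rw [exploreMean]
  linarith

theorem exploreMean_mono [Fintype A] (hA : 2 ≤ Fintype.card A) {ε : ℝ} (h0 : 0 ≤ ε) (h1 : ε ≤ 1)
    {f f' : A → ℝ} (h : ∀ b, f b ≤ f' b) (a : A) : exploreMean ε f a ≤ exploreMean ε f' a := by
  have hA' : (2 : ℝ) ≤ Fintype.card A := by exact_mod_cast hA
  have : (0 : ℝ) < (Fintype.card A : ℝ) - 1 := by linarith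
  have := sub_nonneg.2 h1
  unfold exploreMean
  gcongr <;> apply h

theorem exploreMean_affine [Fintype A] (hA : 2 ≤ Fintype.card A) (ε : ℝ)
    (f : A → ℝ) (x y : ℝ) (a : A) :
    exploreMean ε (fun b => x + y * f b) a = x + y * exploreMean ε f a := by
  classical
  have hA' : (2 : ℝ) ≤ Fintype.card A := by exact_mod_cast hA
  have : (Fintype.card A : ℝ) - 1 ≠ 0 := by linarith
  unfold exploreMean
  rw [Finset.sum_add_distrib, ← Finset.mul_sum, Finset.sum_const,
    Finset.card_erase_of_mem (Finset.mem_univ a), Finset.card_univ, nsmul_eq_mul,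
      Nat.cast_sub (by omega), Nat.cast_one]
  field_simp
  ring

/-- Foster's criterion: a function of the history that decreases by at least one in expectation at
every teaching step bounds the expected teaching length. The invariant `I` restricts the criterion
to histories that can occur. -/
theorem Teacher.expectedLength_le [Fintype A] (T : Teacher S A) (M : MDP S A) (L : Learner S A)
    (Q₀ : QTable S A) (π : S → A) (I : History S A → Prop) (F : History S A → ℝ≥0∞)
    (I_nil : I [])
    (I_step : ∀ h, I h → ¬ Learned π (L.table Q₀ h) → ∀ a, I (T.experience M h a :: h))
    (F_step : ∀ h, I h → ¬ Learned π (L.table Q₀ h) →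
      1 + ∑' a, L.behavior (L.table Q₀ h) (T.current M.H h) a * F (T.experience M h a :: h)
        ≤ F h) :
    T.expectedLength M L Q₀ π ≤ F [] := by
  classical
  -- Off the invariant, the value `⊤` makes the step inequality trivial.
  set G : History S A → ℝ≥0∞ := fun h => h.length + if I h then F h else ⊤ with hG
  have hstep : ∀ h, ¬ Learned π (L.table Q₀ h) →
      ∑' a, L.behavior (L.table Q₀ h) (T.current M.H h) a * G (T.experience M h a :: h) ≤ G h := by
    intro h hL
    by_cases hI : I h
    · have h1 : ∀ a, G (T.experience M h a :: h) =
          ((h.length : ℝ≥0∞) + 1) + F (T.experience M h a :: h) := by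
        intro a
        simp [hG, I_step h hI hL a]
      simp_rw [h1, mul_add (_ : ℝ≥0∞) ((h.length : ℝ≥0∞) + 1)]
      rw [ENNReal.tsum_add, ENNReal.tsum_mul_right, PMF.tsum_coe, one_mul, add_assoc]
      simp only [hG, hI, if_true]
      gcongr
      exact F_step h hI hL
    · simp [hG, hI]
  have hrun : ∀ n, ∑' h, T.run M L Q₀ π n h * G h ≤ F [] := by
    intro n
    induction n with
    | zero => simp [Teacher.run, hG, I_nil]
    | succ n ih =>
      rw [Teacher.run, tsum_pmf_bind_mul]
      refine le_trans (ENNReal.tsum_le_tsum fun h => ?_) ih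
      gcongr
      split_ifs with hL
      · rw [tsum_pmf_pure_mul]
      · rw [tsum_pmf_map_mul]
        exact hstep h hL
  refine iSup_le fun n => le_trans (ENNReal.tsum_le_tsum fun h => ?_) (hrun n)
  gcongr
  exact le_self_add

/-! ### Distances in the transition graph -/

namespace MDP

theorem Reaches.dist_le {M : MDP S A} {n : ℕ} {s : S} (h : M.Reaches n s) : M.dist s ≤ n :=
  iInf₂_le n h

theorem exists_reaches {M : MDP S A} {s : S} (hs : M.dist s ≠ ⊤) :
    ∃ n : ℕ, M.Reaches n s ∧ M.dist s = n := by
  classical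
  have hex : ∃ n, M.Reaches n s := by
    by_contra! h
    exact hs (by simp [MDP.dist, h])
  exact ⟨Nat.find hex, Nat.find_spec hex, le_antisymm (Nat.find_spec hex).dist_le
    (le_iInf₂ fun m hm => by exact_mod_cast Nat.find_min' hex hm)⟩

theorem Init.dist_eq_zero {M : MDP S A} {s : S} (h : M.Init s) : M.dist s = 0 :=
  le_antisymm (by exact_mod_cast (Reaches.init h).dist_le) bot_le

theorem exists_init (M : MDP S A) : ∃ s, M.Init s := by
  obtain ⟨s, hs⟩ := M.μ₀.support_nonempty
  exact ⟨s, M.μ₀.apply_pos_iff s |>.2 hs⟩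

theorem exists_supp (M : MDP S A) (s : S) (a : A) : ∃ s', M.Supp s a s' := by
  obtain ⟨s', hs⟩ := (M.P s a).support_nonempty
  exact ⟨s', (M.P s a).apply_pos_iff s' |>.2 hs⟩

theorem init_or_exists_pred {M : MDP S A} {s : S} (hs : M.dist s ≠ ⊤) :
    M.Init s ∨ ∃ u, (∃ a, M.Supp u a s) ∧ M.dist s = M.dist u + 1 := by
  obtain ⟨n, hn, hd⟩ := exists_reaches hs
  cases hn with
  | init h => exact Or.inl h
  | @step n u _ a h ha =>
    refine Or.inr ⟨u, ⟨a, ha⟩, ?_⟩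
    obtain ⟨m, hm, hu⟩ := exists_reaches (M := M) (s := u)
      (ne_top_of_le_ne_top (ENat.natCast_ne_top n) h.dist_le)
    have h1 := h.dist_le
    have h2 := (hm.step ha).dist_le
    rw [hu] at h1 ⊢
    rw [hd] at h2 ⊢
    norm_cast at *
    omega

/-- The distance of a state as a natural number; only used when it is finite. -/
def depth (M : MDP S A) (s : S) : ℕ := (M.dist s).toNat

theorem dist_ne_top_of_diam {M : MDP S A} {D : ℕ} (h : M.diam = D) (s : S) : M.dist s ≠ ⊤ :=
  ne_top_of_le_ne_top (ENat.natCast_ne_top D) (h ▸ le_iSup M.dist s)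

theorem depth_le_of_diam {M : MDP S A} {D : ℕ} (h : M.diam = D) (s : S) : M.depth s ≤ D :=
  ENat.toNat_le_of_le_natCast (h ▸ le_iSup M.dist s)

end MDP

/-! ### Existence of breadth-first forests with a post-order enumeration -/

section RootPath

variable {α : Type*}

/-- The labels on the path from the root to a state, for a labelling `e`; the first argument is the
number of edges to be followed upwards. -/
def rootPath (parent : S → Option S) (e : S → α) : ℕ → S → List α
  | 0, s => [e s]
  | n + 1, s => match parent s with
    | none => [e s]
    | some u => rootPath parent e n u ++ [e s]

variable {parent : S → Option S} {d : S → ℕ}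

theorem rootPath_of_none (e : S → α) {s : S} (h : parent s = none) (n : ℕ) :
    rootPath parent e n s = [e s] := by
  cases n <;> simp [rootPath, h]

theorem rootPath_of_some (hd : ∀ u s, parent s = some u → d s = d u + 1) (e : S → α) {u s : S}
    (h : parent s = some u) :
    rootPath parent e (d s) s = rootPath parent e (d u) u ++ [e s] := by
  rw [hd u s h]
  simp [rootPath, h]

theorem exists_rootPath_eq (hd : ∀ u s, parent s = some u → d s = d u + 1) (e : S → α) (s : S) :
    ∃ l, rootPath parent e (d s) s = l ++ [e s] := by
  cases h : parent s with
  | none => exact ⟨[], rootPath_of_none e h _⟩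
  | some u => exact ⟨_, rootPath_of_some hd e h⟩

theorem rootPath_injective (hd : ∀ u s, parent s = some u → d s = d u + 1) {e : S → α}
    (he : Function.Injective e) : Function.Injective fun s => rootPath parent e (d s) s := by
  intro s t h
  obtain ⟨l, hl⟩ := exists_rootPath_eq hd e s
  obtain ⟨l', hl'⟩ := exists_rootPath_eq hd e t
  simp only [hl, hl'] at h
  exact he (by simpa using (List.append_inj' h rfl).2)

theorem ancestor_iff_rootPath_prefix (hd : ∀ u s, parent s = some u → d s = d u + 1) {e : S → α}
    (he : Function.Injective e) (v u : S) :
    Ancestor parent v u ↔ rootPath parent e (d v) v <+: rootPath parent e (d u) u := by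
  constructor
  · intro h
    induction h with
    | refl => exact List.prefix_refl _
    | tail _ h ih => exact ih.trans (rootPath_of_some hd e h ▸ List.prefix_append _ _)
  · have main : ∀ n u, d u = n →
        rootPath parent e (d v) v <+: rootPath parent e (d u) u → Ancestor parent v u := by
      intro n
      induction n with
      | zero =>
        intro u hu h
        obtain ⟨l, hl⟩ := exists_rootPath_eq hd e v
        rw [hu, rootPath, hl] at h
        have := h.mem (a := e v) (by simp)
        obtain rfl : v = u := he (by simpa using this)
        exact Relation.ReflTransGen.refl
      | succ n ih =>
        intro u hu h
        cases hp : parent u with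
        | none =>
          obtain ⟨l, hl⟩ := exists_rootPath_eq hd e v
          rw [rootPath_of_none e hp, hl] at h
          have := h.mem (a := e v) (by simp)
          obtain rfl : v = u := he (by simpa using this)
          exact Relation.ReflTransGen.refl
        | some w =>
          rw [rootPath_of_some hd e hp, List.prefix_concat_iff, ← rootPath_of_some hd e hp] at h
          rcases h with h | h
          · rw [rootPath_injective hd he h]
            exact Relation.ReflTransGen.refl
          · exact (ih w (by have := hd w u hp; omega) h).tail hp
    exact main _ u rfl

/-- Mathlib's lexicographic order on lists agrees with the one of the core library. -/
theorem list_le_iff [LinearOrder α] {p q : List α} : p ≤ q ↔ @LE.le _ List.instLE p q :=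
  not_lt.symm

/-- In the lexicographic order the lists that extend `p` form an interval. -/
theorem prefix_of_le_of_le [LinearOrder α] {p q r : List α} (hpq : p ≤ q) (hqr : q ≤ r)
    (h : p <+: r) : p <+: q := by
  induction p generalizing q r with
  | nil => exact List.nil_prefix
  | cons a p ih =>
    obtain ⟨t, rfl⟩ := h
    cases q with
    | nil => exact absurd hpq (by simp)
    | cons b q =>
      rw [List.cons_append, list_le_iff, List.cons_le_cons_iff, ← list_le_iff] at hqr
      rw [list_le_iff, List.cons_le_cons_iff, ← list_le_iff] at hpq
      rcases hpq with h1 | ⟨rfl, h1⟩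
      · rcases hqr with h2 | ⟨rfl, -⟩
        · exact absurd h2 h1.asymm
        · exact absurd h1 (lt_irrefl _)
      · rcases hqr with h2 | ⟨-, h2⟩
        · exact absurd h2 (lt_irrefl _)
        · exact (List.prefix_cons_inj a).2 (ih h1 h2 (List.prefix_append _ _))

end RootPath

/-- Every MDP all of whose states are reachable has a breadth-first forest with a post-order
enumeration. The states are compared through the labels on their root paths: in the lexicographic
order a state precedes its descendants, which form an interval, so the reverse order is a
post-order. -/
theorem nonempty_navPlan [Fintype S] (M : MDP S A) (hM : ∀ s, M.dist s ≠ ⊤) :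
    Nonempty (NavPlan M) := by
  classical
  let parent : S → Option S := fun s =>
    if h : ∃ u, (∃ a, M.Supp u a s) ∧ M.dist s = M.dist u + 1 then some h.choose else none
  have hparent : ∀ u s, parent s = some u → (∃ a, M.Supp u a s) ∧ M.dist s = M.dist u + 1 := by
    intro u s h
    by_cases hex : ∃ u, (∃ a, M.Supp u a s) ∧ M.dist s = M.dist u + 1
    · simp only [parent, dif_pos hex, Option.some.injEq] at h
      exact h ▸ hex.choose_spec
    · simp [parent, dif_neg hex] at h
  have hd : ∀ u s, parent s = some u → M.depth s = M.depth u + 1 := by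
    intro u s h
    rw [MDP.depth, (hparent u s h).2, ENat.toNat_add (hM u) (by simp)]
    rfl
  let e := Fintype.equivFin S
  let key : S → List (Fin (Fintype.card S)) := fun s => rootPath parent e (M.depth s) s
  have key_inj : Function.Injective key := rootPath_injective hd e.injective
  have hanc : ∀ v u, Ancestor parent v u ↔ key v <+: key u :=
    ancestor_iff_rootPath_prefix hd e.injective
  let _ : LinearOrder S := LinearOrder.lift' (fun s => OrderDual.toDual (key s))
    fun s t h => key_inj (OrderDual.toDual_inj.1 h)
  have hle : ∀ u v : S, u ≤ v ↔ key v ≤ key u := fun u v => Iff.rfl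
  let pos := (monoEquivOfFin S rfl).symm
  refine ⟨⟨parent, fun s h => ?_, fun u s h => (hparent u s h).1, fun u s h => (hparent u s h).2,
    pos.toEquiv, fun u v h => ?_, fun u v w h h1 h2 => ?_⟩⟩
  · refine (MDP.init_or_exists_pred (hM s)).resolve_right fun hex => ?_
    simp [parent, dif_pos hex] at h
  · exact pos.monotone ((hle u v).2 (list_le_iff.2 ((hanc v u).1 h).le))
  · rw [hanc] at h ⊢
    exact prefix_of_le_of_le ((hle w v).1 (pos.le_iff_le.1 h2)) ((hle u w).1 (pos.le_iff_le.1 h1)) h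

/-! ### Paths in the forest -/

namespace NavPlan

variable [Fintype S] {M : MDP S A} (p : NavPlan M)

theorem depth_eq (hM : ∀ s, M.dist s ≠ ⊤) {u s : S} (h : p.parent s = some u) :
    M.depth s = M.depth u + 1 := by
  rw [MDP.depth, p.breadth_first u s h, ENat.toNat_add (hM u) (by simp)]
  rfl

theorem depth_le (hM : ∀ s, M.dist s ≠ ⊤) {v u : S} (h : Ancestor p.parent v u) :
    M.depth v ≤ M.depth u := by
  induction h with
  | refl => exact le_rfl
  | tail _ h ih => exact ih.trans (by rw [p.depth_eq hM h]; omega)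

theorem depth_root {s : S} (h : p.parent s = none) : M.depth s = 0 := by
  rw [MDP.depth, (p.root_init s h).dist_eq_zero]
  rfl

theorem exists_root (hM : ∀ s, M.dist s ≠ ⊤) (g : S) :
    ∃ r, p.parent r = none ∧ Ancestor p.parent r g := by
  have main : ∀ n g, M.depth g = n → ∃ r, p.parent r = none ∧ Ancestor p.parent r g := by
    intro n
    induction n with
    | zero =>
      intro g hg
      refine ⟨g, ?_, Relation.ReflTransGen.refl⟩
      cases h : p.parent g with
      | none => rfl
      | some u => have := p.depth_eq hM h; omega
    | succ n ih =>
      intro g hg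
      cases h : p.parent g with
      | none => exact ⟨g, h, Relation.ReflTransGen.refl⟩
      | some u =>
        obtain ⟨r, hr, hru⟩ := ih u (by have := p.depth_eq hM h; omega)
        exact ⟨r, hr, hru.tail h⟩
  exact main _ g rfl

/-- Two ancestors of a state are comparable. -/
theorem ancestor_total {u v g : S} (hu : Ancestor p.parent u g) (hv : Ancestor p.parent v g) :
    Ancestor p.parent u v ∨ Ancestor p.parent v u := by
  induction hu with
  | refl => exact Or.inr hv
  | @tail b c hub hbc ih =>
    rcases Relation.ReflTransGen.cases_tail hv with h | ⟨b', hvb, hbc'⟩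
    · subst h
      exact Or.inl (hub.tail hbc)
    · rw [hbc, Option.some.injEq] at hbc'
      exact ih (hbc' ▸ hvb)

/-- The next state on the path to `g` is unique. -/
theorem child_unique (hM : ∀ s, M.dist s ≠ ⊤) {s c c' g : S} (hc : p.parent c = some s)
    (hc' : p.parent c' = some s) (h : Ancestor p.parent c g) (h' : Ancestor p.parent c' g) :
    c = c' := by
  have key : ∀ {c c'}, p.parent c = some s → p.parent c' = some s → Ancestor p.parent c c' →
      c = c' := by
    intro c c' hc hc' h
    rcases Relation.ReflTransGen.cases_tail h with h | ⟨b, hcb, hb⟩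
    · exact h.symm
    · rw [hc', Option.some.injEq] at hb
      have h1 := p.depth_le hM hcb
      have h2 := p.depth_eq hM hc
      rw [← hb] at h1
      omega
  rcases p.ancestor_total h h' with h | h
  · exact key hc hc' h
  · exact (key hc' hc h).symm

theorem exists_child {s g : S} (h : Ancestor p.parent s g) (hne : s ≠ g) :
    ∃ c, p.parent c = some s ∧ Ancestor p.parent c g := by
  rcases Relation.ReflTransGen.cases_head h with h | ⟨c, hc, hcg⟩
  · exact absurd h hne
  · exact ⟨c, hc, hcg⟩

theorem ne_of_child (hM : ∀ s, M.dist s ≠ ⊤) {s c g : S} (hc : p.parent c = some s)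
    (h : Ancestor p.parent c g) : s ≠ g := by
  rintro rfl
  have h1 := p.depth_le hM h
  have h2 := p.depth_eq hM hc
  omega

theorem pos_lt {s g : S} (h : Ancestor p.parent s g) (hne : s ≠ g) : p.pos g < p.pos s :=
  lt_of_le_of_ne (p.descendant_le g s h) fun e => hne (p.pos.injective e).symm

theorem IsSubtask.unique {p : NavPlan M} {π : S → A} {Q : QTable S A} {g g' : S}
    (h : p.IsSubtask π Q g) (h' : p.IsSubtask π Q g') : g = g' := by
  rcases lt_trichotomy (p.pos g) (p.pos g') with hl | he | hl
  · exact absurd (h'.2 g hl) h.1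
  · exact p.pos.injective he
  · exact absurd (h.2 g' hl) h'.1

theorem IsSubtask.not_learned {p : NavPlan M} {π : S → A} {Q : QTable S A} {g : S}
    (h : p.IsSubtask π Q g) : ¬ Learned π Q := fun hl => h.1 (hl g)

theorem exists_isSubtask {π : S → A} {Q : QTable S A} (h : ¬ Learned π Q) :
    ∃ g, p.IsSubtask π Q g := by
  classical
  rw [Learned, not_forall] at h
  obtain ⟨s, hs⟩ := h
  obtain ⟨g, hg, hmin⟩ := Finset.exists_min_image
    (Finset.univ.filter fun s => ¬ RankedFirst Q s (π s)) p.pos ⟨s, by simpa using hs⟩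
  refine ⟨g, by simpa using hg, fun t ht => ?_⟩
  by_contra hn
  exact absurd (hmin t (by simpa using hn)) (not_le.2 ht)

end NavPlan

/-! ### Actions that block an edge -/

open Classical in
/-- The actions that do not support the transition from `s` to `c` and whose value in the row `x` is
at least that of every action that supports it. These are the actions that still have to be demoted
before the learner greedily follows the edge from `s` to `c`. -/
def blockers [Fintype A] (M : MDP S A) (x : A → ℝ) (s c : S) : Finset A :=
  Finset.univ.filter fun a => ¬ M.Supp s a c ∧ ∀ b, M.Supp s b c → x b ≤ x a

section Blockers

variable [Fintype A] {M : MDP S A} {x y : A → ℝ} {s c : S} {a : A}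

theorem mem_blockers : a ∈ blockers M x s c ↔ ¬ M.Supp s a c ∧ ∀ b, M.Supp s b c → x b ≤ x a := by
  simp [blockers]

theorem card_blockers_le (h : ∃ a, M.Supp s a c) :
    ((blockers M x s c).card : ℝ) ≤ (Fintype.card A : ℝ) - 1 := by
  obtain ⟨a, ha⟩ := h
  have : (blockers M x s c).card < Fintype.card A :=
    Finset.card_lt_univ_of_notMem (x := a) fun hm => (mem_blockers.1 hm).1 ha
  have : ((blockers M x s c).card : ℝ) + 1 ≤ Fintype.card A := by exact_mod_cast this
  linarith

theorem blockers_of_promote (ha : M.Supp s a c) (h : ∀ b, b ≠ a → y b < y a) :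
    blockers M y s c = ∅ := by
  refine Finset.eq_empty_of_forall_notMem fun b hb => ?_
  obtain ⟨hb, hle⟩ := mem_blockers.1 hb
  have hne : b ≠ a := by
    rintro rfl
    exact hb ha
  exact absurd (hle a ha) (not_le.2 (h b hne))

theorem blockers_of_demote_subset [DecidableEq A] (hs : ∃ a, M.Supp s a c) (ha : ¬ M.Supp s a c)
    (hxy : ∀ b, b ≠ a → y b = x b) (h : ∀ b, b ≠ a → y a < y b) :
    blockers M y s c ⊆ (blockers M x s c).erase a := by
  intro b hb
  rw [mem_blockers] at hb
  have hgood : ∀ b, M.Supp s b c → b ≠ a := by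
    rintro b hb rfl
    exact ha hb
  have hne : b ≠ a := by
    rintro rfl
    obtain ⟨a', ha'⟩ := hs
    exact absurd (hb.2 a' ha') (not_le.2 (h a' (hgood a' ha')))
  refine Finset.mem_erase.2 ⟨hne, mem_blockers.2 ⟨hb.1, fun b' hb' => ?_⟩⟩
  rw [← hxy b hne, ← hxy b' (hgood b' hb')]
  exact hb.2 b' hb'

end Blockers

/-! ### The potential of a table -/

open Classical in
/-- The cost of the forest edge that enters `c` while `g` is the subtask: the number of actions that
block it if it is on the path to `g`, zero if it is no longer needed because `c` precedes `g` in the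
enumeration, and the worst case `|A| - 1` if it will be needed only later. -/
def edgeCost [Fintype S] [Fintype A] {M : MDP S A} (p : NavPlan M) (Q : QTable S A) (g c : S) : ℝ :=
  match p.parent c with
  | none => 0
  | some s =>
    if p.pos c < p.pos g then 0
    else if Ancestor p.parent c g then ((blockers M (Q s) s c).card : ℝ)
    else (Fintype.card A : ℝ) - 1

open Classical in
/-- The potential of a table whose subtask is `g`: the cost `w g` of the row of `g`, the worst-case
cost `W` for every state that comes later in the enumeration, and the costs of the edges. -/
def subtaskPotential [Fintype S] [Fintype A] {M : MDP S A} (p : NavPlan M)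
    (w : S → (A → ℝ) → ℝ) (W : ℝ) (Q : QTable S A) (g : S) : ℝ :=
  w g (Q g) + W * ((Finset.univ.filter fun s => p.pos g < p.pos s).card : ℝ) + ∑ c, edgeCost p Q g c

open Classical in
/-- The potential of a table: that of its subtask, or zero if the target policy is learned. -/
def potential [Fintype S] [Fintype A] {M : MDP S A} (p : NavPlan M) (π : S → A)
    (w : S → (A → ℝ) → ℝ) (W : ℝ) (Q : QTable S A) : ℝ :=
  if h : ∃ g, p.IsSubtask π Q g then subtaskPotential p w W Q h.choose else 0

open Classical in
/-- The decrease of the potential that can be expected during the remaining `m` steps of the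
episode if the learner is in `s` and the subtask is `g`: it is the probability that the learner acts
greedily on the way from `s` to `g`, if `s` is on the path to `g` and there is time to act in `g`. -/
def subtaskGain [Fintype S] {M : MDP S A} (p : NavPlan M) (ε : ℝ) (m : ℕ) (s g : S) : ℝ :=
  if Ancestor p.parent s g ∧ M.depth g - M.depth s < m then (1 - ε) ^ (M.depth g - M.depth s) else 0

open Classical in
/-- The gain for the subtask of the table `Q`, or zero if the target policy is learned. -/
def gain [Fintype S] {M : MDP S A} (p : NavPlan M) (π : S → A) (ε : ℝ) (m : ℕ) (s : S)
    (Q : QTable S A) : ℝ :=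
  if h : ∃ g, p.IsSubtask π Q g then subtaskGain p ε m s h.choose else 0

/-- A cost `w` of rows that decreases by at least one in expectation when the learner acts in the
subtask and the teacher reacts by the rule `teach`. Here `teach y g a` says that `y` may be the row
of `g` after the action `a`, and the decrease is only required for tables with the property `I`. -/
structure IsRowCost [Fintype A] (ε : ℝ) (π : S → A) (teach : (A → ℝ) → S → A → Prop)
    (I : QTable S A → Prop) (w : S → (A → ℝ) → ℝ) (W : ℝ) : Prop where
  eq_zero : ∀ g x, (∀ b, b ≠ π g → x b < x (π g)) → w g x = 0
  one_le : ∀ g x, ¬ (∀ b, b ≠ π g → x b < x (π g)) → 1 ≤ w g x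
  le : ∀ g x, w g x ≤ W
  mean_add_one_le : ∀ (Q : QTable S A) (g : S) (y : A → A → ℝ) (a : A), I Q →
    ¬ RankedFirst Q g (π g) → (∀ a b, b ≠ a → y a b = Q g b) → (∀ a, teach (y a) g a) →
    (∀ b, Q g b ≤ Q g a) → exploreMean ε (fun b => w g (y b)) a + 1 ≤ w g (Q g)

/-- The teachers that navigate as NavTeach does, with an arbitrary rule `teach` for the rewards
given in the state of the current subtask. -/
structure Navigates [Fintype S] (M : MDP S A) (L : Learner S A) (Q₀ : QTable S A) (π : S → A)
    (p : NavPlan M) (T : Teacher S A) (teach : (A → ℝ) → S → A → Prop) : Prop where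
  level_three : T.IsLevelThree M
  start_root : ∀ h g, p.IsSubtask π (L.table Q₀ h) g →
    p.parent (T.start h) = none ∧ Ancestor p.parent (T.start h) g
  teach_row : ∀ h g a, p.IsSubtask π (L.table Q₀ h) g → T.current M.H h = g →
    teach (L.update (L.table Q₀ h) (T.experience M h a) g) g a
  navigate_promote : ∀ h g a s c, p.IsSubtask π (L.table Q₀ h) g → T.current M.H h = s →
    p.parent c = some s → Ancestor p.parent c g → M.Supp s a c →
    T.next h a = c ∧ RankedFirst (L.update (L.table Q₀ h) (T.experience M h a)) s a
  navigate_demote : ∀ h g a s c, p.IsSubtask π (L.table Q₀ h) g → T.current M.H h = s →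
    p.parent c = some s → Ancestor p.parent c g → ¬ M.Supp s a c →
    RankedLast (L.update (L.table Q₀ h) (T.experience M h a)) s a
  maintain : ∀ h g a s, p.IsSubtask π (L.table Q₀ h) g → T.current M.H h = s →
    ¬ Ancestor p.parent s g →
    SameRank (L.table Q₀ h) (L.update (L.table Q₀ h) (T.experience M h a)) s a

theorem IsRowCost.nonneg [Fintype A] {ε W : ℝ} {π : S → A}
    {w : S → (A → ℝ) → ℝ} {teach : (A → ℝ) → S → A → Prop}
    {I : QTable S A → Prop}
    (hw : IsRowCost ε π teach I w W) (g : S) (x : A → ℝ) : 0 ≤ w g x := by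
  by_cases h : ∀ b, b ≠ π g → x b < x (π g)
  · rw [hw.eq_zero g x h]
  · exact zero_le_one.trans (hw.one_le g x h)

section Potential

variable [Fintype S] {M : MDP S A} {p : NavPlan M} {π : S → A} {Q Q' : QTable S A}
  {w : S → (A → ℝ) → ℝ} {W ε : ℝ} {g s c : S}

theorem gain_eq (h : p.IsSubtask π Q g) (m : ℕ) (s : S) :
    gain p π ε m s Q = subtaskGain p ε m s g := by
  have hex : ∃ g, p.IsSubtask π Q g := ⟨g, h⟩
  rw [gain, dif_pos hex, hex.choose_spec.unique h]

theorem gain_zero (s : S) : gain p π ε 0 s Q = 0 := by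
  simp [gain, subtaskGain]

theorem subtaskGain_nonneg (hε : ε ≤ 1) (m : ℕ) (s g : S) : 0 ≤ subtaskGain p ε m s g := by
  unfold subtaskGain
  split_ifs
  · exact pow_nonneg (by linarith) _
  · exact le_rfl

theorem subtaskGain_le_one (h0 : 0 ≤ ε) (hε : ε ≤ 1) (m : ℕ) (s g : S) :
    subtaskGain p ε m s g ≤ 1 := by
  unfold subtaskGain
  split_ifs
  · exact pow_le_one₀ (by linarith) (by linarith)
  · exact zero_le_one

theorem gain_nonneg (hε : ε ≤ 1) (m : ℕ) (s : S) (Q : QTable S A) : 0 ≤ gain p π ε m s Q := by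
  unfold gain
  split_ifs
  · exact subtaskGain_nonneg hε _ _ _
  · exact le_rfl

variable [Fintype A]

theorem potential_eq (h : p.IsSubtask π Q g) :
    potential p π w W Q = subtaskPotential p w W Q g := by
  have hex : ∃ g, p.IsSubtask π Q g := ⟨g, h⟩
  rw [potential, dif_pos hex, hex.choose_spec.unique h]

theorem potential_of_learned (h : Learned π Q) : potential p π w W Q = 0 :=
  dif_neg fun ⟨_, hg⟩ => hg.not_learned h

theorem edgeCost_of_none (h : p.parent c = none) : edgeCost p Q g c = 0 := by
  simp [edgeCost, h]

theorem edgeCost_of_ancestor (h : p.parent c = some s) (hc : Ancestor p.parent c g) :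
    edgeCost p Q g c = (blockers M (Q s) s c).card := by
  simp [edgeCost, h, hc, not_lt.2 (p.descendant_le g c hc)]

theorem edgeCost_nonneg (hA : 1 ≤ Fintype.card A) : 0 ≤ edgeCost p Q g c := by
  have hA' : (1 : ℝ) ≤ Fintype.card A := by exact_mod_cast hA
  unfold edgeCost
  split
  · exact le_rfl
  · split_ifs
    · exact le_rfl
    · positivity
    · linarith

theorem edgeCost_le (hA : 1 ≤ Fintype.card A) : edgeCost p Q g c ≤ (Fintype.card A : ℝ) - 1 := by
  have hA' : (1 : ℝ) ≤ Fintype.card A := by exact_mod_cast hA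
  unfold edgeCost
  split
  · linarith
  · rename_i s hs
    split_ifs
    · linarith
    · exact card_blockers_le (p.edge_supp s c hs)
    · exact le_rfl

/-- Only the row of the state that the edge leaves matters for its cost. -/
theorem edgeCost_congr (hrow : ∀ t, t ≠ s → Q' t = Q t)
    (h : p.parent c = some s → ¬ Ancestor p.parent c g) :
    edgeCost p Q' g c = edgeCost p Q g c := by
  cases hc : p.parent c with
  | none => rw [edgeCost_of_none hc, edgeCost_of_none hc]
  | some t =>
    by_cases ht : t = s
    · subst ht
      simp [edgeCost, hc, h hc]
    · simp [edgeCost, hc, hrow t ht]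

/-- Passing to a later subtask does not increase the cost of any edge. An edge on both paths keeps
its cost, and an edge that is not on the old path was counted with the worst case if it may still be
needed. By the post-order there is no third case: an edge that enters a state `c` on the old path is
on the new path too, unless `c` precedes the new subtask. -/
theorem edgeCost_le_of_pos_lt (hA : 1 ≤ Fintype.card A) {g' : S} (hrow : ∀ t, t ≠ g → Q' t = Q t)
    (hpos : p.pos g < p.pos g') : edgeCost p Q' g' c ≤ edgeCost p Q g c := by
  by_cases hcg' : p.pos c < p.pos g'
  · have : edgeCost p Q' g' c = 0 := by
      cases hc : p.parent c with
      | none => exact edgeCost_of_none hc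
      | some t => simp [edgeCost, hc, hcg']
    rw [this]
    exact edgeCost_nonneg hA
  · rw [not_lt] at hcg'
    cases hc : p.parent c with
    | none => rw [edgeCost_of_none hc, edgeCost_of_none hc]
    | some t =>
      by_cases hcg : Ancestor p.parent c g
      · have hcg2 : Ancestor p.parent c g' := p.descendant_block g c g' hcg hpos.le hcg'
        have htg : t ≠ g := by
          rintro rfl
          have := p.descendant_le c t (Relation.ReflTransGen.single hc)
          exact absurd (hpos.trans_le (hcg'.trans this)) (lt_irrefl _)
        rw [edgeCost_of_ancestor hc hcg, edgeCost_of_ancestor hc hcg2, hrow t htg]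
      · refine (edgeCost_le hA).trans (le_of_eq ?_)
        simp [edgeCost, hc, hcg, not_lt.2 (hpos.le.trans hcg')]

theorem subtaskPotential_congr (hrow : ∀ t, t ≠ s → Q' t = Q t) (hs : ¬ Ancestor p.parent s g) :
    subtaskPotential p w W Q' g = subtaskPotential p w W Q g := by
  have hne : g ≠ s := by
    rintro rfl
    exact hs Relation.ReflTransGen.refl
  rw [subtaskPotential, subtaskPotential, hrow g hne]
  congr 1
  exact Finset.sum_congr rfl fun c _ => edgeCost_congr hrow fun hc hcg => hs (hcg.head hc)

theorem subtaskPotential_navigate (hM : ∀ s, M.dist s ≠ ⊤) (hrow : ∀ t, t ≠ s → Q' t = Q t)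
    (hc : p.parent c = some s) (hcg : Ancestor p.parent c g) {x : ℝ}
    (hx : ((blockers M (Q' s) s c).card : ℝ) ≤ (blockers M (Q s) s c).card - x) :
    subtaskPotential p w W Q' g ≤ subtaskPotential p w W Q g - x := by
  classical
  have hne : g ≠ s := (p.ne_of_child hM hc hcg).symm
  have hsum : ∑ c, edgeCost p Q' g c ≤ ∑ c, edgeCost p Q g c - x := by
    rw [← Finset.add_sum_erase _ _ (Finset.mem_univ c),
      ← Finset.add_sum_erase _ (edgeCost p Q g) (Finset.mem_univ c),
      edgeCost_of_ancestor hc hcg, edgeCost_of_ancestor hc hcg,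
      Finset.sum_congr rfl fun c' hc' => edgeCost_congr (p := p) (g := g) hrow fun h h' =>
        (Finset.ne_of_mem_erase hc') (p.child_unique hM h hc h' hcg)]
    linarith
  rw [subtaskPotential, subtaskPotential, hrow g hne]
  linarith

theorem subtaskPotential_same_goal (hM : ∀ s, M.dist s ≠ ⊤) (hrow : ∀ t, t ≠ g → Q' t = Q t) :
    subtaskPotential p w W Q' g = subtaskPotential p w W Q g - w g (Q g) + w g (Q' g) := by
  have hsum : ∑ c, edgeCost p Q' g c = ∑ c, edgeCost p Q g c :=
    Finset.sum_congr rfl fun c _ => edgeCost_congr hrow fun hc hcg => p.ne_of_child hM hc hcg rfl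
  rw [subtaskPotential, subtaskPotential, hsum]
  ring

theorem subtaskPotential_later_goal (hA : 1 ≤ Fintype.card A) (hW : ∀ g x, w g x ≤ W)
    (hW0 : 0 ≤ W) {g' : S} (hrow : ∀ t, t ≠ g → Q' t = Q t) (hpos : p.pos g < p.pos g') :
    subtaskPotential p w W Q' g' ≤ subtaskPotential p w W Q g - w g (Q g) := by
  classical
  have hsum : ∑ c, edgeCost p Q' g' c ≤ ∑ c, edgeCost p Q g c :=
    Finset.sum_le_sum fun c _ => edgeCost_le_of_pos_lt hA hrow hpos
  have hcard : (Finset.univ.filter fun s => p.pos g' < p.pos s).card + 1 ≤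
      (Finset.univ.filter fun s => p.pos g < p.pos s).card := by
    refine Finset.card_lt_card (Finset.ssubset_iff_of_subset ?_ |>.2 ⟨g', ?_, ?_⟩)
    · intro s hs
      simp only [Finset.mem_filter, Finset.mem_univ, true_and] at hs ⊢
      exact hpos.trans hs
    · simpa using hpos
    · simp
  have hcard' : ((Finset.univ.filter fun s => p.pos g' < p.pos s).card : ℝ) + 1 ≤
      (Finset.univ.filter fun s => p.pos g < p.pos s).card := by exact_mod_cast hcard
  have := mul_le_mul_of_nonneg_left hcard' hW0
  have := hW g' (Q' g')
  rw [subtaskPotential, subtaskPotential]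
  linarith

theorem rowCost_le_subtaskPotential (hA : 1 ≤ Fintype.card A) (hW0 : 0 ≤ W) :
    w g (Q g) ≤ subtaskPotential p w W Q g := by
  have : 0 ≤ ∑ c, edgeCost p Q g c := Finset.sum_nonneg fun c _ => edgeCost_nonneg hA
  rw [subtaskPotential]
  have := mul_nonneg hW0 (Nat.cast_nonneg (α := ℝ)
    (Finset.univ.filter fun s => p.pos g < p.pos s).card)
  linarith

theorem subtaskPotential_le (hA : 1 ≤ Fintype.card A) (hW : ∀ g x, w g x ≤ W) (hW0 : 0 ≤ W) :
    subtaskPotential p w W Q g ≤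
      W * Fintype.card S + ((Fintype.card A : ℝ) - 1) * ((Fintype.card S : ℝ) - 1) := by
  classical
  -- An initial state has no parent, so at most `|S| - 1` edges contribute.
  obtain ⟨r, hr⟩ := M.exists_init
  have hroot : p.parent r = none := by
    cases h : p.parent r with
    | none => rfl
    | some u =>
      have := p.breadth_first u r h
      rw [hr.dist_eq_zero] at this
      exact absurd this.symm (by simp)
  have hsum : ∑ c, edgeCost p Q g c ≤
      ((Fintype.card A : ℝ) - 1) * ((Fintype.card S : ℝ) - 1) := by
    rw [← Finset.add_sum_erase _ _ (Finset.mem_univ r), edgeCost_of_none hroot, zero_add]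
    have := Finset.sum_le_card_nsmul (Finset.univ.erase r) (edgeCost p Q g) _
      fun c _ => edgeCost_le hA
    rw [Finset.card_erase_of_mem (Finset.mem_univ r), Finset.card_univ, nsmul_eq_mul,
      Nat.cast_sub (Fintype.card_pos_iff.2 ⟨r⟩), Nat.cast_one] at this
    linarith
  have hcard : (Finset.univ.filter fun s => p.pos g < p.pos s).card < Fintype.card S :=
    Finset.card_lt_univ_of_notMem (x := g) (by simp)
  have hcard' : ((Finset.univ.filter fun s => p.pos g < p.pos s).card : ℝ) + 1 ≤
      Fintype.card S := by exact_mod_cast hcard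
  have := mul_le_mul_of_nonneg_left hcard' hW0
  have := hW g (Q g)
  rw [subtaskPotential]
  linarith

end Potential

/-! ### One teaching step -/

section Step

variable [Fintype S] [Fintype A] {M : MDP S A} {L : Learner S A} {Q₀ : QTable S A} {π : S → A}
  {p : NavPlan M} {T : Teacher S A} {teach : (A → ℝ) → S → A → Prop} {I : QTable S A → Prop}
  {w : S → (A → ℝ) → ℝ} {W : ℝ}

omit [Fintype S] [Fintype A] in
theorem update_row_of_ne (h : History S A) (a : A) {t : S} (ht : t ≠ T.current M.H h) :
    L.update (L.table Q₀ h) (T.experience M h a) t = L.table Q₀ h t := by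
  funext b
  exact L.update_other _ _ _ _ fun hc => ht hc.1

omit [Fintype S] [Fintype A] in
theorem update_of_ne (h : History S A) {a b : A} (s : S) (hb : b ≠ a) :
    L.update (L.table Q₀ h) (T.experience M h a) s b = L.table Q₀ h s b :=
  L.update_other _ _ _ _ fun hc => hb hc.2

omit [Fintype S] [Fintype A] in
theorem SameRank.rankedFirst {Q Q' : QTable S A} {s : S} {a b : A} (h : SameRank Q Q' s a)
    (hother : ∀ c, c ≠ a → Q' s c = Q s c) (hb : RankedFirst Q s b) : RankedFirst Q' s b := by
  intro c hc
  by_cases hba : b = a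
  · subst hba
    exact (h c).2.2 (hb c hc)
  · by_cases hca : c = a
    · subst hca
      exact (h b).1.2 (hb c hc)
    · rw [hother c hca, hother b hba]
      exact hb c hc

omit [Fintype A] in
theorem NavPlan.IsSubtask.of_row {Q Q' : QTable S A} {g s : S} (hg : p.IsSubtask π Q g)
    (hrow : ∀ t, t ≠ s → Q' t = Q t) (hne : s ≠ g)
    (hs : p.pos s < p.pos g → RankedFirst Q s (π s) → RankedFirst Q' s (π s)) :
    p.IsSubtask π Q' g := by
  refine ⟨fun h => hg.1 ?_, fun t ht => ?_⟩
  · intro b hb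
    have := h b hb
    rwa [hrow g hne.symm] at this
  · by_cases hts : t = s
    · subst hts
      exact hs ht (hg.2 t ht)
    · intro b hb
      rw [hrow t hts]
      exact hg.2 t ht b hb

/-- Off the path to the subtask nothing relevant changes. -/
theorem Navigates.off_path (hT : Navigates M L Q₀ π p T teach) {h : History S A} {g : S}
    (hg : p.IsSubtask π (L.table Q₀ h) g) (hs : ¬ Ancestor p.parent (T.current M.H h) g) (a : A) :
    potential p π w W (L.update (L.table Q₀ h) (T.experience M h a)) =
      potential p π w W (L.table Q₀ h) := by
  have hne : T.current M.H h ≠ g := fun e => hs (e ▸ Relation.ReflTransGen.refl)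
  have hrow := fun t (ht : t ≠ T.current M.H h) => update_row_of_ne (L := L) (Q₀ := Q₀) h a ht
  have hg' := hg.of_row hrow hne fun _ hf =>
    (hT.maintain h g a _ hg rfl hs).rankedFirst (fun c hc => update_of_ne h _ hc) hf
  rw [potential_eq hg, potential_eq hg', subtaskPotential_congr hrow hs]

/-- On the path to the subtask no action increases the potential, and an action that blocks the way
decreases it by one. -/
theorem Navigates.on_path (hM : ∀ s, M.dist s ≠ ⊤) (hT : Navigates M L Q₀ π p T teach)
    {h : History S A} {g c : S} (hg : p.IsSubtask π (L.table Q₀ h) g)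
    (hc : p.parent c = some (T.current M.H h)) (hcg : Ancestor p.parent c g) (a : A) :
    p.IsSubtask π (L.update (L.table Q₀ h) (T.experience M h a)) g ∧
    potential p π w W (L.update (L.table Q₀ h) (T.experience M h a)) ≤
      potential p π w W (L.table Q₀ h) ∧
    (a ∈ blockers M (L.table Q₀ h (T.current M.H h)) (T.current M.H h) c →
      potential p π w W (L.update (L.table Q₀ h) (T.experience M h a)) ≤
        potential p π w W (L.table Q₀ h) - 1) := by
  classical
  have hne : T.current M.H h ≠ g := p.ne_of_child hM hc hcg
  have hrow := fun t (ht : t ≠ T.current M.H h) => update_row_of_ne (L := L) (Q₀ := Q₀) h a ht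
  have hlt : p.pos g < p.pos (T.current M.H h) := p.pos_lt (hcg.head hc) hne
  have hg' := hg.of_row hrow hne fun hlt' => absurd (hlt.trans hlt') (lt_irrefl _)
  rw [potential_eq hg, potential_eq hg']
  refine ⟨hg', ?_⟩
  by_cases ha : M.Supp (T.current M.H h) a c
  · have hb := blockers_of_promote ha (hT.navigate_promote h g a _ c hg rfl hc hcg ha).2
    refine ⟨?_, fun hmem => absurd ha (mem_blockers.1 hmem).1⟩
    have := subtaskPotential_navigate (w := w) (W := W) hM hrow hc hcg (x := 0) (by simp [hb])
    linarith
  · have hb := blockers_of_demote_subset (p.edge_supp _ c hc) ha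
      (fun b hb => update_of_ne (L := L) (Q₀ := Q₀) (T := T) (M := M) h (T.current M.H h) hb)
      (hT.navigate_demote h g a _ c hg rfl hc hcg ha)
    constructor
    · have hle : ((blockers M (L.update (L.table Q₀ h) (T.experience M h a) (T.current M.H h))
          (T.current M.H h) c).card : ℝ) ≤
          (blockers M (L.table Q₀ h (T.current M.H h)) (T.current M.H h) c).card := by
        exact_mod_cast Finset.card_le_card (hb.trans (Finset.erase_subset _ _))
      have := subtaskPotential_navigate (w := w) (W := W) hM hrow hc hcg (x := 0) (by simpa using hle)
      linarith
    · intro hmem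
      have hle : (blockers M (L.update (L.table Q₀ h) (T.experience M h a) (T.current M.H h))
          (T.current M.H h) c).card ≤ _ := Finset.card_le_card hb
      rw [Finset.card_erase_of_mem hmem] at hle
      have hpos := Finset.card_pos.2 ⟨a, hmem⟩
      refine subtaskPotential_navigate hM hrow hc hcg ?_
      rw [le_sub_iff_add_le]
      exact_mod_cast (by omega)

/-- In the state of the subtask the potential changes at most as the cost of its row does. -/
theorem Navigates.at_goal (hA : 1 ≤ Fintype.card A) (hM : ∀ s, M.dist s ≠ ⊤)
    (hw : IsRowCost L.ε π teach I w W) (hW0 : 0 ≤ W)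
    {h : History S A} {g : S} (hg : p.IsSubtask π (L.table Q₀ h) g)
    (hs : T.current M.H h = g) (a : A) :
    potential p π w W (L.update (L.table Q₀ h) (T.experience M h a)) ≤
      potential p π w W (L.table Q₀ h) - w g (L.table Q₀ h g) +
        w g (L.update (L.table Q₀ h) (T.experience M h a) g) := by
  have hrow := fun t (ht : t ≠ g) =>
    update_row_of_ne (L := L) (Q₀ := Q₀) h a (by rwa [hs] : t ≠ T.current M.H h)
  rw [potential_eq hg]
  have hwn := hw.nonneg g (L.update (L.table Q₀ h) (T.experience M h a) g)
  by_cases hl : Learned π (L.update (L.table Q₀ h) (T.experience M h a))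
  · rw [potential_of_learned hl]
    have := rowCost_le_subtaskPotential (p := p) (w := w) (W := W) (Q := L.table Q₀ h) (g := g)
      hA hW0
    linarith
  · obtain ⟨g', hg'⟩ := p.exists_isSubtask hl
    rw [potential_eq hg']
    rcases lt_trichotomy (p.pos g) (p.pos g') with hlt | heq | hlt
    · have := subtaskPotential_later_goal (w := w) hA hw.le hW0 hrow hlt
      linarith
    · obtain rfl := p.pos.injective heq
      exact (subtaskPotential_same_goal hM hrow).le
    · refine absurd ?_ hg'.1
      have := hg.2 g' hlt
      have hne : g' ≠ g := fun e => hlt.ne (e ▸ rfl)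
      intro b hb
      rw [hrow g' hne]
      exact this b hb

/-- The key step: after one action, the potential that remains once the gain of the rest of the
episode is deducted is, on average, at most what it was before. -/
theorem Navigates.mean_potential_sub_gain_le (hA : 2 ≤ Fintype.card A) (hM : ∀ s, M.dist s ≠ ⊤)
    (hT : Navigates M L Q₀ π p T teach) (hw : IsRowCost L.ε π teach I w W) (hW0 : 0 ≤ W)
    {h : History S A} (hL : ¬ Learned π (L.table Q₀ h)) (hI : I (L.table Q₀ h)) (m : ℕ) {a : A}
    (ha : ∀ b, L.table Q₀ h (T.current M.H h) b ≤ L.table Q₀ h (T.current M.H h) a) :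
    exploreMean L.ε (fun b =>
        potential p π w W (L.update (L.table Q₀ h) (T.experience M h b)) -
        gain p π L.ε m (T.next h b) (L.update (L.table Q₀ h) (T.experience M h b))) a ≤
      potential p π w W (L.table Q₀ h) -
        gain p π L.ε (m + 1) (T.current M.H h) (L.table Q₀ h) := by
  obtain ⟨g, hg⟩ := p.exists_isSubtask hL
  have h0 : (0 : ℝ) ≤ L.ε := L.ε.2
  have h1 : (L.ε : ℝ) ≤ 1 := by exact_mod_cast L.ε_le_one
  have hgain := fun b => gain_nonneg (p := p) (π := π) h1 m (T.next h b)
    (L.update (L.table Q₀ h) (T.experience M h b))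
  rw [gain_eq hg]
  by_cases hsg : T.current M.H h = g
  · -- In `g` the gain is one, which is the decrease that the row cost provides.
    have h2 := hw.mean_add_one_le (L.table Q₀ h) g
      (fun b => L.update (L.table Q₀ h) (T.experience M h b) g) a hI hg.1
      (fun b c hc => update_of_ne h g hc) (fun b => hT.teach_row h g b hg hsg)
      (by rwa [hsg] at ha)
    refine (exploreMean_mono hA h0 h1 (f' := fun b =>
        (potential p π w W (L.table Q₀ h) - w g (L.table Q₀ h g)) + 1 *
        w g (L.update (L.table Q₀ h) (T.experience M h b) g)) (fun b => ?_) a).trans ?_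
    · rw [one_mul]
      exact (sub_le_self _ (hgain b)).trans (Navigates.at_goal (by omega) hM hw hW0 hg hsg b)
    · rw [exploreMean_affine hA]
      have := subtaskGain_le_one (p := p) h0 h1 (m + 1) (T.current M.H h) g
      linarith
  · by_cases hanc : Ancestor p.parent (T.current M.H h) g
    · obtain ⟨c, hc, hcg⟩ := p.exists_child hanc hsg
      have hon := Navigates.on_path (w := w) (W := W) hM hT hg hc hcg
      have hX : ∀ b, potential p π w W (L.update (L.table Q₀ h) (T.experience M h b)) -
          gain p π L.ε m (T.next h b) (L.update (L.table Q₀ h) (T.experience M h b)) ≤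
          potential p π w W (L.table Q₀ h) := fun b =>
        (sub_le_self _ (hgain b)).trans (hon b).2.1
      -- A greedy action either moves on to `c` or is one of the blockers.
      have hgreedy : potential p π w W (L.update (L.table Q₀ h) (T.experience M h a)) -
          gain p π L.ε m (T.next h a) (L.update (L.table Q₀ h) (T.experience M h a)) ≤
          potential p π w W (L.table Q₀ h) - subtaskGain p L.ε m c g := by
        by_cases hsupp : M.Supp (T.current M.H h) a c
        · rw [gain_eq (hon a).1, (hT.navigate_promote h g a _ c hg rfl hc hcg hsupp).1]
          linarith [(hon a).2.1]
        · have h2 := (hon a).2.2 (mem_blockers.2 ⟨hsupp, fun b _ => ha b⟩)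
          have := subtaskGain_le_one (p := p) h0 h1 m c g
          linarith [hgain a]
      refine (exploreMean_le hA h0 h1 hX hgreedy).trans ?_
      have hd := p.depth_eq hM hc
      have hle := p.depth_le hM hcg
      have hmul : subtaskGain p L.ε (m + 1) (T.current M.H h) g =
          (1 - L.ε) * subtaskGain p L.ε m c g := by
        have hexp : M.depth g - M.depth (T.current M.H h) = (M.depth g - M.depth c) + 1 := by omega
        unfold subtaskGain
        simp only [hanc, hcg, true_and, hexp, add_lt_add_iff_right]
        split_ifs
        · rw [pow_succ]; ring
        · rw [mul_zero]
      rw [hmul]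
    · have hX : ∀ b, potential p π w W (L.update (L.table Q₀ h) (T.experience M h b)) -
          gain p π L.ε m (T.next h b) (L.update (L.table Q₀ h) (T.experience M h b)) ≤
          potential p π w W (L.table Q₀ h) := fun b =>
        (sub_le_self _ (hgain b)).trans (hT.off_path hg hanc b).le
      refine (exploreMean_le hA h0 h1 hX (x := 0) (by simpa using hX a)).trans ?_
      simp [subtaskGain, hanc]

end Step

/-! ### The bound on the expected teaching length -/

section Bound

variable [Fintype S] [Fintype A] {M : MDP S A} {L : Learner S A} {Q₀ : QTable S A} {π : S → A}
  {p : NavPlan M} {T : Teacher S A} {teach : (A → ℝ) → S → A → Prop} {I : QTable S A → Prop}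
  {w : S → (A → ℝ) → ℝ} {W : ℝ}

theorem gain_le_potential (hA : 1 ≤ Fintype.card A) (hw : IsRowCost L.ε π teach I w W)
    (hW0 : 0 ≤ W) (m : ℕ) (s : S) (Q : QTable S A) :
    gain p π L.ε m s Q ≤ potential p π w W Q := by
  by_cases h : ∃ g, p.IsSubtask π Q g
  · obtain ⟨g, hg⟩ := h
    rw [gain_eq hg, potential_eq hg]
    have h1 : (L.ε : ℝ) ≤ 1 := by exact_mod_cast L.ε_le_one
    exact (subtaskGain_le_one L.ε.2 h1 m s g).trans ((hw.one_le g (Q g) hg.1).trans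
      (rowCost_le_subtaskPotential hA hW0))
  · simp [gain, potential, h]

theorem potential_le (hA : 1 ≤ Fintype.card A) (hw : IsRowCost L.ε π teach I w W)
    (hW0 : 0 ≤ W) (Q : QTable S A) :
    potential p π w W Q ≤
      W * Fintype.card S + ((Fintype.card A : ℝ) - 1) * ((Fintype.card S : ℝ) - 1) := by
  unfold potential
  split_ifs
  · exact subtaskPotential_le hA hw.le hW0
  · have hA' : (1 : ℝ) ≤ Fintype.card A := by exact_mod_cast hA
    have hS : (1 : ℝ) ≤ Fintype.card S := by
      exact_mod_cast Fintype.card_pos_iff.2 (M.exists_init.nonempty)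
    have := mul_nonneg (sub_nonneg.2 hA') (sub_nonneg.2 hS)
    positivity

open Classical in
/-- An upper bound on the expected remaining teaching length: the number of steps left in the
episode, and `H / (1 - ε) ^ D` steps for every unit of potential that is expected to be left after
it. -/
def remainingBound (M : MDP S A) (L : Learner S A) (Q₀ : QTable S A) (π : S → A) (p : NavPlan M)
    (T : Teacher S A) (w : S → (A → ℝ) → ℝ) (W : ℝ) (D : ℕ) (h : History S A) : ℝ :=
  if Learned π (L.table Q₀ h) then 0
  else ((M.H - h.length % M.H : ℕ) : ℝ) + M.H / (1 - L.ε) ^ D *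
    (potential p π w W (L.table Q₀ h) -
      gain p π L.ε (M.H - h.length % M.H) (T.current M.H h) (L.table Q₀ h))

theorem remainingBound_nonneg (hA : 1 ≤ Fintype.card A) (hw : IsRowCost L.ε π teach I w W)
    (hW0 : 0 ≤ W) (D : ℕ) (h : History S A) : 0 ≤ remainingBound M L Q₀ π p T w W D h := by
  unfold remainingBound
  split_ifs
  · exact le_rfl
  · have h1 : (0 : ℝ) ≤ 1 - L.ε := sub_nonneg.2 (by exact_mod_cast L.ε_le_one)
    have := gain_le_potential (p := p) hA hw hW0 (M.H - h.length % M.H) (T.current M.H h)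
      (L.table Q₀ h)
    have := sub_nonneg.2 this
    positivity

/-- At the start of an episode the learner is in the root of the subtask's tree, and the expected
decrease of the potential pays for the whole episode. -/
theorem Navigates.remainingBound_le_of_start (hA : 1 ≤ Fintype.card A)
    {D : ℕ} (hD : M.diam = D) (hH : D < M.H)
    (hT : Navigates M L Q₀ π p T teach) (hw : IsRowCost L.ε π teach I w W) (hW0 : 0 ≤ W)
    (hq : 0 < (1 - (L.ε : ℝ)) ^ D) {h : History S A} (hh : h.length % M.H = 0) :
    remainingBound M L Q₀ π p T w W D h ≤
      M.H / (1 - L.ε) ^ D * potential p π w W (L.table Q₀ h) := by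
  have h1 : (0 : ℝ) ≤ 1 - L.ε := sub_nonneg.2 (by exact_mod_cast L.ε_le_one)
  unfold remainingBound
  split_ifs with hL
  · have := gain_le_potential (p := p) hA hw hW0 0 (T.current M.H h) (L.table Q₀ h)
    rw [gain_zero] at this
    positivity
  · obtain ⟨g, hg⟩ := p.exists_isSubtask hL
    have hcur : T.current M.H h = T.start h := by
      cases h with
      | nil => rfl
      | cons e h => simp only [Teacher.current]; rw [if_pos hh]
    obtain ⟨hr, hrg⟩ := hT.start_root h g hg
    have hgain : (1 - (L.ε : ℝ)) ^ D ≤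
        gain p π L.ε (M.H - h.length % M.H) (T.current M.H h) (L.table Q₀ h) := by
      have hdg := MDP.depth_le_of_diam hD g
      rw [gain_eq hg, hcur, subtaskGain, p.depth_root hr, if_pos ⟨hrg, by omega⟩]
      exact pow_le_pow_of_le_one h1 (by linarith [L.ε.2]) (by omega)
    rw [hh, Nat.sub_zero] at hgain ⊢
    have hK : (M.H : ℝ) / (1 - L.ε) ^ D * (1 - L.ε) ^ D = M.H := div_mul_cancel₀ _ hq.ne'
    have := mul_le_mul_of_nonneg_left hgain (by positivity : 0 ≤ (M.H : ℝ) / (1 - L.ε) ^ D)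
    rw [mul_sub]
    linarith

theorem Navigates.expectedLength_le (hA : 2 ≤ Fintype.card A)
    {D : ℕ} (hD : M.diam = D) (hH : D < M.H)
    (hT : Navigates M L Q₀ π p T teach) (hw : IsRowCost L.ε π teach I w W) (hW0 : 0 ≤ W)
    (hq : 0 < (1 - (L.ε : ℝ)) ^ D) (hI : I Q₀)
    (hIstep : ∀ h, ¬ Learned π (L.table Q₀ h) → I (L.table Q₀ h) →
      ∀ a, I (L.update (L.table Q₀ h) (T.experience M h a))) :
    T.expectedLength M L Q₀ π ≤ ENNReal.ofReal (M.H / (1 - L.ε) ^ D *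
      (W * Fintype.card S + ((Fintype.card A : ℝ) - 1) * ((Fintype.card S : ℝ) - 1))) := by
  have hM := MDP.dist_ne_top_of_diam hD
  have hH0 : 0 < M.H := by omega
  have hF0 := remainingBound_nonneg (M := M) (Q₀ := Q₀) (p := p) (T := T)
    (by omega : 1 ≤ Fintype.card A) hw hW0 D
  have hK : 0 ≤ (M.H : ℝ) / (1 - L.ε) ^ D := by positivity
  refine (T.expectedLength_le M L Q₀ π (fun h => I (L.table Q₀ h))
    (fun h => ENNReal.ofReal (remainingBound M L Q₀ π p T w W D h)) hI
    (fun h hI hL a => hIstep h hL hI a) fun h hI hL => ?_).trans (ENNReal.ofReal_le_ofReal ?_)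
  · obtain ⟨m, hm⟩ : ∃ m, M.H - h.length % M.H = m + 1 :=
      ⟨M.H - h.length % M.H - 1, by have := Nat.mod_lt h.length hH0; omega⟩
    have hnext : ∀ a, remainingBound M L Q₀ π p T w W D (T.experience M h a :: h) ≤
        m + M.H / (1 - L.ε) ^ D *
          (potential p π w W (L.update (L.table Q₀ h) (T.experience M h a)) -
          gain p π L.ε m (T.next h a) (L.update (L.table Q₀ h) (T.experience M h a))) := by
      intro a
      have hlt := Nat.mod_lt h.length hH0
      by_cases hm0 : m = 0
      · have hmod : (h.length + 1) % M.H = 0 := by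
          rw [Nat.add_mod_eq_ite]
          rcases Nat.lt_or_ge 1 M.H with h2 | h2
          · rw [Nat.mod_eq_of_lt h2, if_pos (by omega)]; omega
          · have : M.H = 1 := by omega
            simp [this, Nat.mod_one]
        have := hT.remainingBound_le_of_start (by omega) hD hH hw hW0 hq
          (h := T.experience M h a :: h) (by simpa using hmod)
        simpa [hm0, gain_zero, Learner.table] using this
      · have hmod : (h.length + 1) % M.H = h.length % M.H + 1 := by
          rw [Nat.add_mod_eq_ite, Nat.mod_eq_of_lt (by omega : 1 < M.H), if_neg (by omega)]
        have hcur : T.current M.H (T.experience M h a :: h) = T.next h a := by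
          simp only [Teacher.current, List.length_cons, hmod]
          rw [if_neg (by omega)]
          rfl
        unfold remainingBound
        split_ifs with hL'
        · have := gain_le_potential (p := p) (by omega : 1 ≤ Fintype.card A) hw hW0 m (T.next h a)
            (L.update (L.table Q₀ h) (T.experience M h a))
          have := mul_nonneg hK (sub_nonneg.2 this)
          positivity
        · have hm' : M.H - (T.experience M h a :: h).length % M.H = m := by
            rw [List.length_cons, hmod]; omega
          rw [hm', hcur]
          exact le_rfl
    have hX : ∀ a, (∀ b, L.table Q₀ h (T.current M.H h) b ≤ L.table Q₀ h (T.current M.H h) a) →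
        exploreMean L.ε
          (fun a => remainingBound M L Q₀ π p T w W D (T.experience M h a :: h)) a ≤
        remainingBound M L Q₀ π p T w W D h - 1 := by
      intro a ha
      refine (exploreMean_mono hA L.ε.2 (by exact_mod_cast L.ε_le_one) hnext a).trans ?_
      rw [exploreMean_affine hA, remainingBound, if_neg hL, hm]
      have := mul_le_mul_of_nonneg_left
        (hT.mean_potential_sub_gain_le hA hM hw hW0 hL hI m ha) hK
      exact le_of_le_of_eq (add_le_add_right this (m : ℝ)) (by push_cast; ring)
    have h1 := tsum_behavior_mul_le hA L (L.table Q₀ h) (T.current M.H h) _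
      (fun a => hF0 (T.experience M h a :: h)) _ hX
    have hone : 1 ≤ remainingBound M L Q₀ π p T w W D h := by
      have := gain_le_potential (p := p) (by omega : 1 ≤ Fintype.card A) hw hW0 (m + 1)
        (T.current M.H h) (L.table Q₀ h)
      have := mul_nonneg hK (sub_nonneg.2 this)
      rw [remainingBound, if_neg hL, hm]
      push_cast
      have : (0 : ℝ) ≤ m := Nat.cast_nonneg m
      linarith
    calc _ ≤ 1 + ENNReal.ofReal (remainingBound M L Q₀ π p T w W D h - 1) := by gcongr
      _ = ENNReal.ofReal (remainingBound M L Q₀ π p T w W D h) := by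
        rw [← ENNReal.ofReal_one, ← ENNReal.ofReal_add zero_le_one (by linarith)]
        congr 1
        ring
  · refine (hT.remainingBound_le_of_start (by omega) hD hH hw hW0 hq (by simp)).trans ?_
    gcongr
    exact potential_le (by omega) hw hW0 _

omit [Fintype S] in
/-- With a single action every policy is learned from the outset. -/
theorem expectedLength_eq_zero [Subsingleton A] (T : Teacher S A) (M : MDP S A)
    (L : Learner S A) (Q₀ : QTable S A) (π : S → A) : T.expectedLength M L Q₀ π = 0 :=
  le_antisymm (T.expectedLength_le M L Q₀ π (fun _ => True) (fun _ => 0) trivial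
    (fun _ _ _ _ => trivial) fun _ _ hL =>
      absurd (fun _ _ hb => absurd (Subsingleton.elim _ _) hb) hL) bot_le

end Bound

/-! ### The cost of a row under the rule of NavTeach -/

section NavRule

open Classical in
/-- The actions other than the target action `t` that are not strictly below it in the row `x`. -/
def rivals [Fintype A] (x : A → ℝ) (t : A) : Finset A :=
  Finset.univ.filter fun b => b ≠ t ∧ x t ≤ x b

/-- NavTeach's rule in the state of the subtask: the target action is promoted, every other action is
demoted. -/
def navRule (π : S → A) (y : A → ℝ) (g : S) (a : A) : Prop :=
  (a = π g → ∀ b, b ≠ a → y b < y a) ∧ (a ≠ π g → ∀ b, b ≠ a → y a < y b)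

/-- The expected number of visits to the state of the subtask until the target action is learned, if
it has `k` rivals among the `n` other actions and is not greedy itself. It solves
`c k * visits k = 1 + c (k - 1) * visits (k - 1)`, where `c k = 1 - ε + ε * k / n` is the probability
that a visit makes progress: the greedy action, any other rival or the target action is played. -/
def visits (ε n k : ℝ) : ℝ := k / (1 - ε + ε * k / n)

variable {ε n k : ℝ}

theorem visits_zero : visits ε n 0 = 0 := by simp [visits]

theorem visits_denom_pos (h0 : 0 ≤ ε) (h1 : ε ≤ 1) (hn : 0 < n) (hk : 0 < k) :
    0 < 1 - ε + ε * k / n := by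
  rcases h0.eq_or_lt with rfl | h
  · simp
  · have : 0 < ε * k / n := by positivity
    linarith

theorem visits_nonneg (h0 : 0 ≤ ε) (h1 : ε ≤ 1) (hn : 0 < n) (hk : 0 ≤ k) :
    0 ≤ visits ε n k := by
  have := sub_nonneg.2 h1
  unfold visits
  positivity

theorem visits_le (h0 : 0 ≤ ε) (h1 : ε ≤ 1) (hn : 0 < n) (hk : 0 ≤ k) (hkn : k ≤ n) :
    visits ε n k ≤ n := by
  rcases hk.eq_or_lt with rfl | hk
  · rw [visits_zero]; exact hn.le
  · rw [visits, div_le_iff₀ (visits_denom_pos h0 h1 hn hk)]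
    have : n * (1 - ε + ε * k / n) = n * (1 - ε) + ε * k := by field_simp
    nlinarith

theorem one_le_visits (h0 : 0 ≤ ε) (h1 : ε ≤ 1) (hn : 0 < n) (hk : 1 ≤ k) (hkn : k ≤ n) :
    1 ≤ visits ε n k := by
  rw [visits, le_div_iff₀ (visits_denom_pos h0 h1 hn (by linarith)), one_mul]
  have : ε * k / n ≤ ε := by
    rw [div_le_iff₀ hn]
    exact mul_le_mul_of_nonneg_left hkn h0
  linarith

theorem denom_mul_visits (h0 : 0 ≤ ε) (h1 : ε ≤ 1) (hn : 0 < n) (hk : 0 ≤ k) :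
    (1 - ε + ε * k / n) * visits ε n k = k := by
  rcases hk.eq_or_lt with rfl | hk
  · rw [visits_zero, mul_zero]
  · exact mul_div_cancel₀ _ (visits_denom_pos h0 h1 hn hk).ne'

variable [Fintype A] {x y : A → ℝ} {t a : A}

theorem mem_rivals {b : A} : b ∈ rivals x t ↔ b ≠ t ∧ x t ≤ x b := by simp [rivals]

theorem card_rivals_le (x : A → ℝ) (t : A) :
    ((rivals x t).card : ℝ) ≤ (Fintype.card A : ℝ) - 1 := by
  have : (rivals x t).card < Fintype.card A :=
    Finset.card_lt_univ_of_notMem (x := t) fun h => (mem_rivals.1 h).1 rfl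
  have : ((rivals x t).card : ℝ) + 1 ≤ Fintype.card A := by exact_mod_cast this
  linarith

theorem rivals_eq_empty_iff : rivals x t = ∅ ↔ ∀ b, b ≠ t → x b < x t := by
  simp [Finset.eq_empty_iff_forall_notMem, mem_rivals]

theorem rivals_of_demote [DecidableEq A] (hat : a ≠ t) (hxy : ∀ b, b ≠ a → y b = x b)
    (hlast : ∀ b, b ≠ a → y a < y b) : rivals y t = (rivals x t).erase a := by
  ext b
  rw [Finset.mem_erase, mem_rivals, mem_rivals]
  by_cases hb : b = a
  · subst hb
    simpa using fun _ => hlast t hat.symm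
  · rw [hxy b hb, hxy t hat.symm]
    simp [hb]

theorem sum_erase_visits [DecidableEq A] (y : A → A → ℝ)
    (hxy : ∀ a b, b ≠ a → y a b = x b) (hfirst : ∀ b, b ≠ t → y t b < y t t)
    (hlast : ∀ a, a ≠ t → ∀ b, b ≠ a → y a a < y a b) (a : A) :
    ∑ b ∈ Finset.univ.erase a, visits ε n ((rivals (y b) t).card) =
      ((Fintype.card A : ℝ) - 1) * visits ε n (rivals x t).card +
      (rivals x t).card * (visits ε n ((rivals x t).card - 1) - visits ε n (rivals x t).card) -
      visits ε n ((rivals (y a) t).card) := by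
  have hb : ∀ b, visits ε n ((rivals (y b) t).card) =
      visits ε n (rivals x t).card + (if t = b then - visits ε n (rivals x t).card else 0) +
      (if b ∈ rivals x t then
        visits ε n ((rivals x t).card - 1) - visits ε n (rivals x t).card else 0) := by
    intro b
    by_cases hbt : b = t
    · subst hbt
      have : rivals (y b) b = ∅ := rivals_eq_empty_iff.2 hfirst
      have hn : b ∉ rivals x b := fun h => (mem_rivals.1 h).1 rfl
      simp [this, visits_zero, hn]
    · rw [rivals_of_demote hbt (hxy b) (hlast b hbt), if_neg (Ne.symm hbt)]
      by_cases hm : b ∈ rivals x t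
      · rw [Finset.card_erase_of_mem hm, Nat.cast_sub (Finset.card_pos.2 ⟨b, hm⟩), if_pos hm]
        push_cast
        ring
      · simp [hm]
  have hsum : ∑ b, visits ε n ((rivals (y b) t).card) =
      ((Fintype.card A : ℝ) - 1) * visits ε n (rivals x t).card +
      (rivals x t).card * (visits ε n ((rivals x t).card - 1) - visits ε n (rivals x t).card) := by
    simp_rw [hb, Finset.sum_add_distrib]
    rw [Finset.sum_ite_eq, Finset.sum_ite_mem, Finset.univ_inter, Finset.sum_const,
      Finset.sum_const, Finset.card_univ]
    simp
    ring
  rw [← hsum, ← Finset.add_sum_erase _ _ (Finset.mem_univ a)]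
  ring

/-- The expected number of visits is a row cost for the rule of NavTeach. A tie of the target action
with the greedy action is harmless if the greedy action is at least as likely as any other one. -/
theorem isRowCost_navRule (hA : 2 ≤ Fintype.card A) (h0 : 0 ≤ ε) (h1 : ε ≤ 1) (π : S → A) :
    IsRowCost ε π (navRule π)
      (fun Q => (∀ s, Function.Injective (Q s)) ∨
        ε ≤ ((Fintype.card A : ℝ) - 1) / (Fintype.card A : ℝ))
      (fun g x => visits ε ((Fintype.card A : ℝ) - 1) (rivals x (π g)).card)
      ((Fintype.card A : ℝ) - 1) := by
  classical
  have hA' : (2 : ℝ) ≤ Fintype.card A := by exact_mod_cast hA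
  have hn : (0 : ℝ) < (Fintype.card A : ℝ) - 1 := by linarith
  have hk1 : ∀ {x : A → ℝ} {t : A}, ¬ (∀ b, b ≠ t → x b < x t) →
      (1 : ℝ) ≤ (rivals x t).card := by
    intro x t h
    rw [← rivals_eq_empty_iff, ← Finset.not_nonempty_iff_eq_empty, not_not, ← Finset.card_pos] at h
    exact_mod_cast h
  refine ⟨fun g x h => ?_, fun g x h => ?_, fun g x => ?_, fun Q g y a hI hg hy hteach ha => ?_⟩
  · simp [rivals_eq_empty_iff.2 h, visits_zero]
  · exact one_le_visits h0 h1 hn (hk1 h) (card_rivals_le _ _)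
  · exact visits_le h0 h1 hn (Nat.cast_nonneg _) (card_rivals_le _ _)
  · have hk := hk1 hg
    have hsum := sum_erase_visits (ε := ε) (n := (Fintype.card A : ℝ) - 1) (t := π g) y hy
      ((hteach (π g)).1 rfl) (fun b hb => (hteach b).2 hb) a
    have e1 := denom_mul_visits h0 h1 hn (zero_le_one.trans hk)
    have e2 := denom_mul_visits h0 h1 hn (sub_nonneg.2 hk)
    have hv' := visits_nonneg h0 h1 hn (sub_nonneg.2 hk)
    rw [exploreMean, hsum]
    by_cases hag : a = π g
    · have hca : rivals (y a) (π g) = ∅ := by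
        subst hag
        exact rivals_eq_empty_iff.2 ((hteach (π g)).1 rfl)
      simp only [hca, Finset.card_empty, Nat.cast_zero, visits_zero]
      have hε : ε ≤ ((Fintype.card A : ℝ) - 1) / (Fintype.card A : ℝ) := by
        refine hI.resolve_left fun hinj => hg fun b hb => ?_
        rw [← hag] at hb ⊢
        exact lt_of_le_of_ne (ha b) fun e => hb (hinj g e)
      rw [le_div_iff₀ (by linarith)] at hε
      set n := (Fintype.card A : ℝ) - 1 with hndef
      set k := ((rivals (Q g) (π g)).card : ℝ) with hkdef
      set v := visits ε n k
      set v' := visits ε n (k - 1)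
      have hc : ε * k / n ≤ 1 - ε + ε * (k - 1) / n := by
        have : ε / n ≤ 1 - ε := by
          rw [div_le_iff₀ hn]
          have : (Fintype.card A : ℝ) = n + 1 := by rw [hndef]; ring
          rw [this] at hε
          linarith
        have e : ε * (k - 1) / n = ε * k / n - ε / n := by ring
        linarith
      have := mul_le_mul_of_nonneg_right hc hv'
      have e3 : ε * ((n * v + k * (v' - v) - 0) / n) = ε * v + ε * k / n * v' - ε * k / n * v := by
        field_simp
        ring
      rw [e3]
      linarith
    · have hm : a ∈ rivals (Q g) (π g) := mem_rivals.2 ⟨hag, ha _⟩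
      rw [rivals_of_demote hag (hy a) ((hteach a).2 hag), Finset.card_erase_of_mem hm,
        Nat.cast_sub (Finset.card_pos.2 ⟨a, hm⟩), Nat.cast_one]
      set n := (Fintype.card A : ℝ) - 1
      set k := ((rivals (Q g) (π g)).card : ℝ)
      set v := visits ε n k
      set v' := visits ε n (k - 1)
      have e3 : ε * ((n * v + k * (v' - v) - v') / n) =
          ε * v + ε * (k - 1) / n * v' - ε * k / n * v := by
        field_simp
        ring
      rw [e3]
      linarith

end NavRule

/-! ### The cost of a row when every action is promoted -/

section PromoteRule

/-- The rule that promotes every action in the state of the subtask. -/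
def promoteRule (y : A → ℝ) (_ : S) (a : A) : Prop := ∀ b, b ≠ a → y b < y a

open Classical in
/-- A bound on the number of visits under `promoteRule`: once the best action is unique, the target
action is chosen by exploration with probability `ε / n`, which takes at most `2 * n` visits if
`1 / 2 ≤ ε`; one more visit makes the best action unique. -/
def promoteVisits (n : ℝ) (t : A) (x : A → ℝ) : ℝ :=
  if ∀ b, b ≠ t → x b < x t then 0
  else if ∃ a, ∀ b, b ≠ a → x b < x a then 2 * n else 2 * n + 1

theorem isRowCost_promoteRule [Fintype A] (hA : 2 ≤ Fintype.card A) {ε : ℝ} (h0 : 1 / 2 ≤ ε)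
    (h1 : ε ≤ 1) (π : S → A) :
    IsRowCost ε π promoteRule (fun _ => True)
      (fun g => promoteVisits ((Fintype.card A : ℝ) - 1) (π g))
      (2 * ((Fintype.card A : ℝ) - 1) + 1) := by
  classical
  have hA' : (2 : ℝ) ≤ Fintype.card A := by exact_mod_cast hA
  refine ⟨fun g x h => if_pos h, fun g x h => ?_, fun g x => ?_,
    fun Q g y a _ hg hy hteach ha => ?_⟩
  · rw [promoteVisits, if_neg h]
    split_ifs <;> linarith
  · unfold promoteVisits
    split_ifs <;> linarith
  · have hval : ∀ b, promoteVisits ((Fintype.card A : ℝ) - 1) (π g) (y b) =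
        2 * ((Fintype.card A : ℝ) - 1) - if π g = b then 2 * ((Fintype.card A : ℝ) - 1) else 0 := by
      intro b
      by_cases hb : π g = b
      · rw [promoteVisits, if_pos (by rw [hb]; exact hteach b), if_pos hb, sub_self]
      · have : ¬ ∀ c, c ≠ π g → y b c < y b (π g) := fun h =>
          (h b (Ne.symm hb)).asymm (hteach b (π g) hb)
        rw [promoteVisits, if_neg this, if_pos ⟨b, hteach b⟩, if_neg hb, sub_zero]
    have hle : ∀ b, promoteVisits ((Fintype.card A : ℝ) - 1) (π g) (y b) ≤
        2 * ((Fintype.card A : ℝ) - 1) := by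
      intro b
      rw [hval]
      split_ifs <;> linarith
    by_cases htop : ∃ c, ∀ b, b ≠ c → Q g b < Q g c
    · have hw : promoteVisits ((Fintype.card A : ℝ) - 1) (π g) (Q g) =
          2 * ((Fintype.card A : ℝ) - 1) := by
        exact (if_neg hg).trans (if_pos htop)
      obtain ⟨c, hc⟩ := htop
      have hca : c = a := by
        by_contra hne
        exact absurd (ha c) (not_le.2 (hc a (Ne.symm hne)))
      subst hca
      have hct : π g ≠ c := fun e => hg (by rw [e]; exact hc)
      rw [hw, exploreMean]
      simp_rw [hval]
      rw [Finset.sum_sub_distrib, Finset.sum_const, Finset.sum_ite_eq,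
        if_pos (Finset.mem_erase.2 ⟨hct, Finset.mem_univ _⟩), if_neg hct,
        Finset.card_erase_of_mem (Finset.mem_univ c), Finset.card_univ, nsmul_eq_mul,
        Nat.cast_sub (by omega), Nat.cast_one]
      have hn : (Fintype.card A : ℝ) - 1 ≠ 0 := by linarith
      have e : (((Fintype.card A : ℝ) - 1) * (2 * ((Fintype.card A : ℝ) - 1)) -
          2 * ((Fintype.card A : ℝ) - 1)) / ((Fintype.card A : ℝ) - 1) =
          2 * ((Fintype.card A : ℝ) - 1) - 2 := by
        field_simp
      rw [e]
      linarith
    · have hw : promoteVisits ((Fintype.card A : ℝ) - 1) (π g) (Q g) =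
          2 * ((Fintype.card A : ℝ) - 1) + 1 := by
        exact (if_neg hg).trans (if_neg htop)
      have := exploreMean_le hA (by linarith) h1 hle (a := a) (x := 0) (by simpa using hle a)
      linarith

end PromoteRule

/-! ### Existence of navigating teachers -/

/-- Every plan is followed by some teacher. The current state depends on the teacher only through
its initial states, so these are chosen before the rewards and the next states. -/
theorem NavPlan.exists_navigates [Fintype S] {M : MDP S A} (p : NavPlan M)
    (hM : ∀ s, M.dist s ≠ ⊤) (L : Learner S A) (Q₀ : QTable S A) (π : S → A)
    (teach : (A → ℝ) → S → A → Prop)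
    (hteach : ∀ Q g a s', ∃ r, teach (L.update Q ⟨g, a, r, s'⟩ g) g a) :
    ∃ T : Teacher S A, Navigates M L Q₀ π p T teach := by
  have hstart : ∀ h, ∃ s, M.Init s ∧ ∀ g, p.IsSubtask π (L.table Q₀ h) g →
      p.parent s = none ∧ Ancestor p.parent s g := by
    intro h
    by_cases hex : ∃ g, p.IsSubtask π (L.table Q₀ h) g
    · obtain ⟨g, hg⟩ := hex
      obtain ⟨r, hr, hrg⟩ := p.exists_root hM g
      exact ⟨r, p.root_init r hr, fun g' hg' => hg.unique hg' ▸ ⟨hr, hrg⟩⟩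
    · obtain ⟨s, hs⟩ := M.exists_init
      exact ⟨s, hs, fun g hg => absurd ⟨g, hg⟩ hex⟩
  choose start hinit hroot using hstart
  let cur : History S A → S := fun h =>
    Teacher.current ⟨start, fun _ _ => 0, fun h _ => start h⟩ M.H h
  have hstep : ∀ h a, ∃ (s' : S) (r : ℝ), M.Supp (cur h) a s' ∧
      ∀ g, p.IsSubtask π (L.table Q₀ h) g →
        (cur h = g → teach (L.update (L.table Q₀ h) ⟨cur h, a, r, s'⟩ g) g a) ∧
        (∀ c, p.parent c = some (cur h) → Ancestor p.parent c g →
          (M.Supp (cur h) a c → s' = c ∧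
            RankedFirst (L.update (L.table Q₀ h) ⟨cur h, a, r, s'⟩) (cur h) a) ∧
          (¬ M.Supp (cur h) a c →
            RankedLast (L.update (L.table Q₀ h) ⟨cur h, a, r, s'⟩) (cur h) a)) ∧
        (¬ Ancestor p.parent (cur h) g →
          SameRank (L.table Q₀ h) (L.update (L.table Q₀ h) ⟨cur h, a, r, s'⟩) (cur h) a) := by
    intro h a
    obtain ⟨s', hs'⟩ := M.exists_supp (cur h) a
    by_cases hex : ∃ g, p.IsSubtask π (L.table Q₀ h) g
    · obtain ⟨g, hg⟩ := hex
      by_cases hsg : cur h = g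
      · obtain ⟨r, hr⟩ := hteach (L.table Q₀ h) g a s'
        refine ⟨s', r, hs', fun g' hg' => ?_⟩
        obtain rfl := hg.unique hg'
        refine ⟨fun _ => by rw [hsg]; exact hr, fun c hc hcg => ?_, fun hn => ?_⟩
        · exact absurd hsg (p.ne_of_child hM hc hcg)
        · exact absurd (hsg ▸ Relation.ReflTransGen.refl) hn
      · by_cases hanc : Ancestor p.parent (cur h) g
        · obtain ⟨c, hc, hcg⟩ := p.exists_child hanc hsg
          by_cases hsupp : M.Supp (cur h) a c
          · obtain ⟨r, hr⟩ := L.exists_promote (L.table Q₀ h) (cur h) a c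
            refine ⟨c, r, hsupp, fun g' hg' => ?_⟩
            obtain rfl := hg.unique hg'
            refine ⟨fun e => absurd e hsg, fun c' hc' hcg' => ?_, fun hn => absurd hanc hn⟩
            obtain rfl := p.child_unique hM hc hc' hcg hcg'
            exact ⟨fun _ => ⟨rfl, hr⟩, fun hn => absurd hsupp hn⟩
          · obtain ⟨r, hr⟩ := L.exists_demote (L.table Q₀ h) (cur h) a s'
            refine ⟨s', r, hs', fun g' hg' => ?_⟩
            obtain rfl := hg.unique hg'
            refine ⟨fun e => absurd e hsg, fun c' hc' hcg' => ?_, fun hn => absurd hanc hn⟩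
            obtain rfl := p.child_unique hM hc hc' hcg hcg'
            exact ⟨fun hs => absurd hs hsupp, fun _ => hr⟩
        · obtain ⟨r, hr⟩ := L.exists_maintain (L.table Q₀ h) (cur h) a s'
          refine ⟨s', r, hs', fun g' hg' => ?_⟩
          obtain rfl := hg.unique hg'
          exact ⟨fun e => absurd e hsg, fun c hc hcg => absurd
            (Relation.ReflTransGen.head (r := fun u v => p.parent v = some u) hc hcg) hanc, fun _ => hr⟩
    · exact ⟨s', 0, hs', fun g hg => absurd ⟨g, hg⟩ hex⟩
  choose next reward hsupp hnav using hstep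
  have hcur : ∀ h, Teacher.current ⟨start, reward, next⟩ M.H h = cur h := fun h => by
    cases h <;> rfl
  refine ⟨⟨start, reward, next⟩, fun h => ⟨hinit h, fun a => ?_⟩, hroot, fun h g a hg hs => ?_,
    fun h g a s c hg hs hc hcg hsu => ?_, fun h g a s c hg hs hc hcg hsu => ?_,
    fun h g a s hg hs hn => ?_⟩
  · rw [hcur]
    exact hsupp h a
  · rw [hcur] at hs
    rw [Teacher.experience, hcur]
    exact (hnav h a g hg).1 hs
  · subst hs
    rw [hcur] at hc hsu
    rw [Teacher.experience, hcur]
    exact ((hnav h a g hg).2.1 c hc hcg).1 hsu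
  · subst hs
    rw [hcur] at hc hsu
    rw [Teacher.experience, hcur]
    exact ((hnav h a g hg).2.1 c hc hcg).2 hsu
  · subst hs
    rw [hcur] at hn
    rw [Teacher.experience, hcur]
    exact (hnav h a g hg).2.2 hn

theorem isNavTeach_iff_navigates [Fintype S] {M : MDP S A} {L : Learner S A} {Q₀ : QTable S A}
    {π : S → A} {p : NavPlan M} {T : Teacher S A} :
    IsNavTeach M L Q₀ π p T ↔ Navigates M L Q₀ π p T (navRule π) :=
  ⟨fun h => ⟨h.level_three, h.start_root,
      fun h' g a hg hs => ⟨h.teach_promote h' g a hg hs, h.teach_demote h' g a hg hs⟩,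
      h.navigate_promote, h.navigate_demote, h.maintain⟩,
    fun h => ⟨h.level_three, h.start_root,
      fun h' g a hg hs => (h.teach_row h' g a hg hs).1,
      fun h' g a hg hs => (h.teach_row h' g a hg hs).2,
      h.navigate_promote, h.navigate_demote, h.maintain⟩⟩

theorem NavPlan.exists_isNavTeach [Fintype S] {M : MDP S A} (p : NavPlan M)
    (hM : ∀ s, M.dist s ≠ ⊤) (L : Learner S A) (Q₀ : QTable S A) (π : S → A) :
    ∃ T : Teacher S A, IsNavTeach M L Q₀ π p T := by
  simp_rw [isNavTeach_iff_navigates]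
  refine p.exists_navigates hM L Q₀ π _ fun Q g a s' => ?_
  by_cases ha : a = π g
  · obtain ⟨r, hr⟩ := L.exists_promote Q g a s'
    exact ⟨r, fun _ => hr, fun hn => absurd ha hn⟩
  · obtain ⟨r, hr⟩ := L.exists_demote Q g a s'
    exact ⟨r, fun h => absurd h ha, fun _ => hr⟩

/-! ### The bounds for NavTeach and for the teaching dimension -/

/-- Under NavTeach rows without equal entries stay so. -/
theorem IsNavTeach.injective_update [Fintype S] {M : MDP S A} {L : Learner S A}
    {Q₀ : QTable S A} {π : S → A} {p : NavPlan M} {T : Teacher S A}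
    (hT : IsNavTeach M L Q₀ π p T) {h : History S A} (hL : ¬ Learned π (L.table Q₀ h))
    (hinj : ∀ s, Function.Injective (L.table Q₀ h s)) (a : A) (s : S) :
    Function.Injective (L.update (L.table Q₀ h) (T.experience M h a) s) := by
  by_cases hs : s = T.current M.H h
  · have hother : ∀ b, b ≠ a → L.update (L.table Q₀ h) (T.experience M h a) s b =
        L.table Q₀ h s b := fun b hb => update_of_ne h s hb
    have key : ∀ b, b ≠ a → L.update (L.table Q₀ h) (T.experience M h a) s b ≠
        L.update (L.table Q₀ h) (T.experience M h a) s a := by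
      obtain ⟨g, hg⟩ := p.exists_isSubtask hL
      intro b hb
      by_cases hanc : Ancestor p.parent s g
      · by_cases hsg : s = g
        · by_cases ha : a = π g
          · rw [hsg]
            exact (hT.teach_promote h g a hg (hs.symm.trans hsg) ha b hb).ne
          · rw [hsg]
            exact (hT.teach_demote h g a hg (hs.symm.trans hsg) ha b hb).ne'
        · obtain ⟨c, hc, hcg⟩ := p.exists_child hanc hsg
          by_cases hsu : M.Supp s a c
          · exact ((hT.navigate_promote h g a s c hg hs.symm hc hcg hsu).2 b hb).ne
          · exact (hT.navigate_demote h g a s c hg hs.symm hc hcg hsu b hb).ne'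
      · have hr := hT.maintain h g a s hg hs.symm hanc b
        rcases lt_or_gt_of_ne (fun e => hb (hinj s e) :
          L.table Q₀ h s b ≠ L.table Q₀ h s a) with hlt | hlt
        · exact (hr.2.2 hlt).ne
        · exact (hr.1.2 hlt).ne'
    intro b c hbc
    by_cases hb : b = a
    · by_contra hne
      subst hb
      exact key c (Ne.symm hne) hbc.symm
    · by_cases hc : c = a
      · subst hc
        exact absurd hbc (key b hb)
      · rw [hother b hb, hother c hc] at hbc
        exact hinj s hbc
  · rw [update_row_of_ne h a hs]
    exact hinj s

/-- Passage to `ℝ≥0∞`: for `ε = 1` and `D ≠ 0` the bound is infinite. -/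
theorem le_mul_div_pow {ε : ℝ≥0} {H N D : ℕ} (hε : ε ≤ 1) (hN : N ≠ 0) (hH : H ≠ 0) {x : ℝ≥0∞}
    (hx : 0 < (1 - (ε : ℝ)) ^ D → x ≤ ENNReal.ofReal (H / (1 - (ε : ℝ)) ^ D * N)) :
    x ≤ N * H * (1 / (1 - (ε : ℝ≥0∞))) ^ D := by
  have hε' : (ε : ℝ) ≤ 1 := by exact_mod_cast hε
  have hsub : 1 - (ε : ℝ≥0∞) = ENNReal.ofReal (1 - ε) := by
    rw [ENNReal.ofReal_sub _ ε.coe_nonneg, ENNReal.ofReal_one, ENNReal.ofReal_coe_nnreal]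
  by_cases hq : 0 < (1 - (ε : ℝ)) ^ D
  · refine (hx hq).trans (le_of_eq ?_)
    rw [hsub, one_div, ← ENNReal.inv_pow, ← ENNReal.ofReal_pow (sub_nonneg.2 hε'),
      ← ENNReal.ofReal_inv_of_pos hq, div_mul_eq_mul_div, div_eq_mul_inv, mul_comm (H : ℝ),
      ENNReal.ofReal_mul (by positivity), ENNReal.ofReal_mul (by positivity),
      ENNReal.ofReal_natCast, ENNReal.ofReal_natCast]
  · have hD : D ≠ 0 := by
      rintro rfl
      simp at hq
    have h0 : 1 - (ε : ℝ) ≤ 0 := not_lt.1 fun h => hq (pow_pos h D)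
    rw [hsub, ENNReal.ofReal_of_nonpos h0]
    simp [hD, hN, hH, ENNReal.mul_top]

theorem IsNavTeach.expectedLength_le [Fintype S] [Fintype A] {M : MDP S A} {L : Learner S A}
    {Q₀ : QTable S A} {π : S → A} {p : NavPlan M} {T : Teacher S A} {D : ℕ}
    (hT : IsNavTeach M L Q₀ π p T) (hD : M.diam = D) (hH : D < M.H)
    (hQ : (∀ s, Function.Injective (Q₀ s)) ∨
      (L.ε : ℝ) ≤ ((Fintype.card A : ℝ) - 1) / (Fintype.card A : ℝ)) :
    T.expectedLength M L Q₀ π ≤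
      ((2 * Fintype.card S - 1 : ℕ) : ℝ≥0∞) * ((Fintype.card A - 1 : ℕ) : ℝ≥0∞) *
        (M.H : ℝ≥0∞) * (1 / (1 - (L.ε : ℝ≥0∞))) ^ D := by
  rcases Nat.lt_or_ge (Fintype.card A) 2 with hA | hA
  · have := Fintype.card_le_one_iff_subsingleton.1 (by omega : Fintype.card A ≤ 1)
    rw [expectedLength_eq_zero]
    exact bot_le
  · have hS : 0 < Fintype.card S := Fintype.card_pos_iff.2 M.exists_init.nonempty
    have hA' : (2 : ℝ) ≤ Fintype.card A := by exact_mod_cast hA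
    rw [← Nat.cast_mul]
    refine le_mul_div_pow L.ε_le_one (Nat.mul_ne_zero (by omega) (by omega)) (by omega) fun hq => ?_
    refine ((isNavTeach_iff_navigates.1 hT).expectedLength_le hA hD hH
      (isRowCost_navRule hA L.ε.2 (by exact_mod_cast L.ε_le_one) π) (by linarith) hq hQ
      fun h hL hI a => ?_).trans (le_of_eq ?_)
    · exact hI.imp (fun hinj => hT.injective_update hL hinj a) id
    · congr 2
      push_cast [Nat.cast_sub (by omega : 1 ≤ 2 * Fintype.card S),
        Nat.cast_sub (by omega : 1 ≤ Fintype.card A)]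
      ring

/-- For every MDP and every goal there is a good teacher: NavTeach if the learner explores little,
and otherwise its variant that promotes every action in the state of the subtask. -/
theorem METaL_le [Fintype S] [Fintype A] (M : MDP S A) (L : Learner S A)
    (Q₀ : QTable S A) (π : S → A) {D : ℕ} (hD : M.diam = D) (hH : D < M.H) :
    METaL M L Q₀ π ≤ 4 * (Fintype.card S : ℝ≥0∞) * (Fintype.card A : ℝ≥0∞) * (M.H : ℝ≥0∞) *
      (1 / (1 - (L.ε : ℝ≥0∞))) ^ D := by
  have hM := MDP.dist_ne_top_of_diam hD
  obtain ⟨p⟩ := nonempty_navPlan M hM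
  have hS : 0 < Fintype.card S := Fintype.card_pos_iff.2 M.exists_init.nonempty
  by_cases hε : (L.ε : ℝ) ≤ ((Fintype.card A : ℝ) - 1) / (Fintype.card A : ℝ)
  · obtain ⟨T, hT⟩ := p.exists_isNavTeach hM L Q₀ π
    refine (iInf₂_le T hT.level_three).trans ((hT.expectedLength_le hD hH (Or.inr hε)).trans ?_)
    gcongr
    · calc ((2 * Fintype.card S - 1 : ℕ) : ℝ≥0∞) ≤ ((4 * Fintype.card S : ℕ) : ℝ≥0∞) := by
            exact_mod_cast (by omega)
        _ = _ := by push_cast; rfl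
    · omega
  · obtain ⟨T, hT⟩ := p.exists_navigates hM L Q₀ π promoteRule
      fun Q g a s' => L.exists_promote Q g a s'
    refine (iInf₂_le T hT.level_three).trans ?_
    rcases Nat.lt_or_ge (Fintype.card A) 2 with hA | hA
    · have := Fintype.card_le_one_iff_subsingleton.1 (by omega : Fintype.card A ≤ 1)
      rw [expectedLength_eq_zero]
      exact bot_le
    · have hA' : (2 : ℝ) ≤ Fintype.card A := by exact_mod_cast hA
      have hS' : (1 : ℝ) ≤ Fintype.card S := by exact_mod_cast hS
      have hcast : (4 : ℝ≥0∞) * (Fintype.card S : ℝ≥0∞) * (Fintype.card A : ℝ≥0∞) =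
          ((4 * Fintype.card S * Fintype.card A : ℕ) : ℝ≥0∞) := by
        push_cast
        rfl
      rw [hcast]
      refine le_mul_div_pow L.ε_le_one (Nat.mul_ne_zero (by omega) (by omega)) (by omega)
        fun hq => ?_
      have hhalf : 1 / 2 ≤ (L.ε : ℝ) := by
        refine le_trans ?_ (not_le.1 hε).le
        rw [div_le_div_iff₀ (by norm_num) (by linarith)]
        linarith
      refine (hT.expectedLength_le hA hD hH
        (isRowCost_promoteRule hA hhalf (by exact_mod_cast L.ε_le_one) π) (by linarith) hq trivial
        fun _ _ _ _ => trivial).trans (ENNReal.ofReal_le_ofReal ?_)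
      gcongr
      push_cast
      nlinarith

end Teaching

end

theorem theorem4 :
    ∃ C : ℝ≥0, ∀ (S : Type*) (A : Type*) [Fintype S] [Fintype A] (L : Teaching.Learner S A)
      (H D : ℕ) (_ : D < H) (𝓜 : Set (Teaching.MDP S A))
      (_ : ∀ M ∈ 𝓜, M.H = H ∧ M.diam = (D : ℕ∞)),
      Teaching.TDim L 𝓜 ≤
          (C : ℝ≥0∞) * (Fintype.card S : ℝ≥0∞) * (Fintype.card A : ℝ≥0∞) * (H : ℝ≥0∞) *
            (1 / (1 - (L.ε : ℝ≥0∞))) ^ D ∧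
        ∀ M ∈ 𝓜, Nonempty (Teaching.NavPlan M) ∧
          ∀ (p : Teaching.NavPlan M) (Q₀ : Teaching.QTable S A) (π : S → A),
            (∃ T : Teaching.Teacher S A, Teaching.IsNavTeach M L Q₀ π p T) ∧
            ∀ T : Teaching.Teacher S A, Teaching.IsNavTeach M L Q₀ π p T →
              ((∀ s, Function.Injective (Q₀ s)) ∨
                (L.ε : ℝ) ≤ ((Fintype.card A : ℝ) - 1) / (Fintype.card A : ℝ)) →
              T.expectedLength M L Q₀ π ≤
                ((2 * Fintype.card S - 1 : ℕ) : ℝ≥0∞) * ((Fintype.card A - 1 : ℕ) : ℝ≥0∞) *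
                  (H : ℝ≥0∞) * (1 / (1 - (L.ε : ℝ≥0∞))) ^ D := by
  refine ⟨4, fun S A _ _ L H D hDH 𝓜 h𝓜 => ⟨?_, fun M hM => ?_⟩⟩
  · refine iSup₂_le fun M hM => iSup₂_le fun Q₀ π => ?_
    obtain ⟨rfl, hD⟩ := h𝓜 M hM
    exact Teaching.METaL_le M L Q₀ π hD hDH
  · obtain ⟨rfl, hD⟩ := h𝓜 M hM
    have hfin := Teaching.MDP.dist_ne_top_of_diam hD
    exact ⟨Teaching.nonempty_navPlan M hfin, fun p Q₀ π => ⟨p.exists_isNavTeach hfin L Q₀ π,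
      fun T hT hQ => hT.expectedLength_le hD hDH hQ⟩⟩
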